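/- **Setting.** Consider a partitioned initial value problem $\dot y^{S}=f^{S}(t,y^{S},y^{F})$, $\dot y^{F}=f^{F}(t,y^{S},y^{F})$ on $[t_0,T]$ with $y^{S}(t)\in\mathbb R^{d_S}$, $y^{F}(t)\in\mathbb R^{d_F}$ and given initial values. Fix $m\ge 1$; a macro step has size $H$, a micro step has size $h=H/m$, and $t_n=t_0+nH$. *Basic schemes.* A one-step scheme $\Phi$ maps a right-hand side $g$, a time $t$, a step size $h$ and a value $y$ to an approximation of $u(t+h)$, where $\dot u=g(t,u)$, $u(t)=y$. It has order $p$ if there is $\kappa\ge1$ such that for all $\rho>0$ and $M$ there are $C$ and $h_0>0$ such that $\|\Phi(g,t,h,y)-u(t+h)\|\le C h^{p+1}$ whenever $0<h\le h_0$, $g$ is of class $C^p$, all derivatives of $g$ (in time and state) of order $0,\dots,p$ are bounded by $M$ on $\{(s,x):|s-t|\le\kappa h,\ \|x-y\|\le\rho\}$, and $u$ solves the above problem on $[t,t+h]$. *Spline rules.* A spline rule with $m$ subintervals turns values $v_0,\dots,v_m$ at $a+iH/m$ ($0\le i\le m$) and slopes $d_0,d_1$ at $a$ and $a+H$ into a waveform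 $w$. It has order $q$ if there are real polynomials $\omega_0,\dots,\omega_m,\delta_0,\delta_1$ of degree $<q$ such that for all $a$ and all $H>0$ $$w(t)=\sum_i\omega_i(\theta)v_i+H\bigl(\delta_0(\theta)d_0+\delta_1(\theta)d_1\bigr),\qquad \theta=(t-a)/H,$$ and such that $\sum_i\omega_i(\theta)P(i/m)+\delta_0(\theta)P'(0)+\delta_1(\theta)P'(1)=P(\theta)$ for every polynomial $P$ of degree $<q$. The *clamped cubic rule* takes as $w$ the cubic polynomial that coincides on the last subinterval $[a+H-H/m,\,a+H]$ with the clamped cubic spline of the data, that is, with the $C^2$ function on $[a,a+H]$ that is cubic on each subinterval, has values $v_i$ at the nodes and has end slopes $d_0,d_1$. For $m=1$ this is the cubic polynomial with prescribed values and slopes at both ends. *The multirate scheme (decoupled slowest-first).* On the first window $[t_0,t_1]$ do $m$ steps of size $h$ of a one-step scheme $\Phi_0$ for the full coupled system. On $[t_n,t_{n+1}]$, $n\ge1$: 1. apply a spline rule with $m$ subintervals to the fast values $y^{F}_{n-1+i/m}$ ($0\le i\le m$) and the slopes $f^{F}(t_{n-1},y^{S}_{n-1},y^{F}_{n-1})$,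 $f^{F}(t_n,y^{S}_n,y^{F}_n)$ of the previous window, and extrapolate it to a waveform $\tilde y^{F}$; 2. obtain $y^{S}_{n+1}$ from $y^S_n$ by one step of size $H$ of a one-step scheme $\Phi_S$ for $\dot x=f^{S}(t,x,\tilde y^{F}(t))$; 3. obtain a waveform $\hat y^{S}$ by a spline rule with one subinterval from $y^{S}_n$, $y^{S}_{n+1}$, $f^{S}(t_n,y^{S}_n,y^{F}_n)$, $f^{S}(t_{n+1},y^{S}_{n+1},\tilde y^{F}(t_{n+1}))$; 4. obtain $y^{F}_{n+i/m}$, $1\le i\le m$, from $y^F_n$ by $m$ steps of size $h$ of a one-step scheme $\Phi_F$ for $\dot x=f^{F}(t,\hat y^{S}(t),x)$. *Convergence.* All problems considered have $t_0<T$, right-hand sides $f^S,f^F$ that are defined and of class $C^p$ on $\mathbb R\times\mathbb R^{d_S}\times\mathbb R^{d_F}$, and a solution on $[t_0,T]$. The method is convergent if for every such problem and every $\varepsilon>0$ there is $H_0>0$ such that for all $0<H\le H_0$ and $N\ge1$ with $t_0+NH\le T$ the scheme can be carried out for $N$ macro steps and all computed macro values of $y^{S}$ and all macro and micro values of $y^{F}$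 differ from the solution at the corresponding times by at most $\varepsilon$. It is of order $r$ if for every such problem there are $C$ and $H_0>0$ such that the same holds with $\varepsilon$ replaced by $C H^r$. **Theorem.** Let $m,p\ge1$ and let $\Phi_S,\Phi_F,\Phi_0$ be of order $p$. 1. If both spline rules are of order $q\ge1$, then the multirate scheme is convergent, and it is of order $\min(p,q)$. 2. With the clamped cubic rule for both the extrapolation and the interpolation, the multirate scheme is convergent and of order $\min(p,4)$. In particular, if $p\ge4$, it is of order four. -/

import Mathlib

/-! Spline-oriented multirate schemes based on the decoupled slowest-first approach. -/

/-- A one-step integration scheme on `E`: `Φ g t h y` is the numerical approximation at time `t + h`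
of the solution of `u' = g(·, u)`, `u(t) = y`. -/
abbrev OneStep (E : Type*) := (ℝ → E → E) → ℝ → ℝ → E → E

/-- `u` solves `u' = g(·, u)` on `[a, b]` (one-sided derivatives at the end points). -/
def SolvesODE {E : Type*} [NormedAddCommGroup E] [NormedSpace ℝ E]
    (g : ℝ → E → E) (a b : ℝ) (u : ℝ → E) : Prop :=
  ∀ t ∈ Set.Icc a b, HasDerivWithinAt u (g t (u t)) (Set.Icc a b) t

/-- Order `p` of a one-step scheme: the local error is `O(h ^ (p + 1))`, where the constant and the
step size bound depend only on a bound `M` for the derivatives up to order `p` of the right-hand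
side near the initial point. The number `κ` says how far (in multiples of `h`) the scheme may
look in time; a Runge-Kutta scheme with abscissae `c i` has `κ = max (1, |c i|)`. -/
def OneStep.HasOrder {E : Type*} [NormedAddCommGroup E] [NormedSpace ℝ E]
    (Φ : OneStep E) (p : ℕ) : Prop :=
  ∃ κ : ℝ, 1 ≤ κ ∧ ∀ ρ : ℝ, 0 < ρ → ∀ M : ℝ, ∃ C h₀ : ℝ, 0 < h₀ ∧
    ∀ (g : ℝ → E → E) (t h : ℝ) (y : E) (u : ℝ → E),
      0 < h → h ≤ h₀ →
      ContDiff ℝ p (fun z : ℝ × E => g z.1 z.2) →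
      (∀ k ≤ p, ∀ s x, |s - t| ≤ κ * h → ‖x - y‖ ≤ ρ →
        ‖iteratedFDeriv ℝ k (fun z : ℝ × E => g z.1 z.2) (s, x)‖ ≤ M) →
      SolvesODE g t (t + h) u → u t = y →
      ‖Φ g t h y - u (t + h)‖ ≤ C * h ^ (p + 1)

/-- A rule that turns the data of one window `[a, a + H]`, namely the values `v i` at the nodes
`a + i * (H / m)`, `i = 0, …, m`, and the slopes `d₀`, `d₁` at the end points `a`, `a + H`, into a
waveform `w`. `R a H v d₀ d₁ w` says that `w` is a waveform which the rule produces. -/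
abbrev SplineRule (m : ℕ) (E : Type*) :=
  ℝ → ℝ → (Fin (m + 1) → E) → E → E → (ℝ → E) → Prop

/-- Spline approximation of order `q`: the waveform is a polynomial piece of degree less than `q`
which depends linearly, and in an affinely invariant way, on the data, and the rule reproduces all
polynomials of degree less than `q`. -/
def SplineRule.HasOrder {m : ℕ} {E : Type*} [NormedAddCommGroup E] [NormedSpace ℝ E]
    (R : SplineRule m E) (q : ℕ) : Prop :=
  ∃ (ω : Fin (m + 1) → Polynomial ℝ) (δ₀ δ₁ : Polynomial ℝ),
    (∀ i, (ω i).degree < q) ∧ δ₀.degree < q ∧ δ₁.degree < q ∧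
    (∀ P : Polynomial ℝ, P.degree < q → ∀ θ : ℝ,
      ∑ i : Fin (m + 1), (ω i).eval θ * P.eval ((i : ℝ) / m)
        + δ₀.eval θ * P.derivative.eval 0 + δ₁.eval θ * P.derivative.eval 1 = P.eval θ) ∧
    ∀ (a H : ℝ) (v : Fin (m + 1) → E) (d₀ d₁ : E) (w : ℝ → E), 0 < H →
      (R a H v d₀ d₁ w ↔ ∀ t : ℝ,
        w t = ∑ i : Fin (m + 1), (ω i).eval ((t - a) / H) • v i
          + H • (δ₀.eval ((t - a) / H) • d₀ + δ₁.eval ((t - a) / H) • d₁))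

/-- `w` is a (vector-valued) polynomial of degree at most three. -/
def IsCubic {E : Type*} [NormedAddCommGroup E] [NormedSpace ℝ E] (w : ℝ → E) : Prop :=
  ∃ c : Fin 4 → E, ∀ t : ℝ, w t = ∑ k : Fin 4, t ^ (k : ℕ) • c k

/-- `s` is, on `[a, a + H]`, the clamped cubic spline with equidistant nodes `a + i * (H / m)`, node
values `v i` and end slopes `d₀`, `d₁`. -/
structure IsClampedCubicSpline {m : ℕ} {E : Type*} [NormedAddCommGroup E] [NormedSpace ℝ E]
    (a H : ℝ) (v : Fin (m + 1) → E) (d₀ d₁ : E) (s : ℝ → E) : Prop where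
  contDiff : ContDiffOn ℝ 2 s (Set.Icc a (a + H))
  cubic : ∀ i : ℕ, i < m → ∃ w : ℝ → E, IsCubic w ∧
    Set.EqOn s w (Set.Icc (a + i * (H / m)) (a + (i + 1) * (H / m)))
  value : ∀ i : Fin (m + 1), s (a + (i : ℝ) * (H / m)) = v i
  slope_left : HasDerivWithinAt s d₀ (Set.Icc a (a + H)) a
  slope_right : HasDerivWithinAt s d₁ (Set.Icc a (a + H)) (a + H)

/-- The clamped cubic spline rule: the waveform is the cubic polynomial which agrees with the clamped
cubic spline of the data on the last subinterval `[a + H - H / m, a + H]`. For `m = 1` it is the cubic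
polynomial with prescribed values and slopes at `a` and `a + H`. -/
def clampedCubicRule (m : ℕ) (E : Type*) [NormedAddCommGroup E] [NormedSpace ℝ E] :
    SplineRule m E :=
  fun a H v d₀ d₁ w => IsCubic w ∧ ∃ s : ℝ → E, IsClampedCubicSpline a H v d₀ d₁ s ∧
    Set.EqOn w s (Set.Icc (a + H - H / m) (a + H))

/-- A partitioned initial value problem on `[t₀, T]`. -/
structure PartitionedIVP (ES EF : Type*) where
  fS : ℝ → ES → EF → ES
  fF : ℝ → ES → EF → EF
  t₀ : ℝ
  T : ℝ
  initS : ES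
  initF : EF

section

variable {ES EF : Type*} [NormedAddCommGroup ES] [NormedSpace ℝ ES]
  [NormedAddCommGroup EF] [NormedSpace ℝ EF]

/-- The right-hand side of the full coupled system. -/
def PartitionedIVP.full (P : PartitionedIVP ES EF) : ℝ → ES × EF → ES × EF :=
  fun t z => (P.fS t z.1 z.2, P.fF t z.1 z.2)

/-- Both right-hand sides are `k` times continuously differentiable. -/
def PartitionedIVP.Smooth (P : PartitionedIVP ES EF) (k : ℕ) : Prop :=
  ContDiff ℝ k (fun z : ℝ × ES × EF => P.fS z.1 z.2.1 z.2.2) ∧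
    ContDiff ℝ k (fun z : ℝ × ES × EF => P.fF z.1 z.2.1 z.2.2)

/-- `(uS, uF)` is an exact solution on `[t₀, T]`. -/
def PartitionedIVP.IsSolution (P : PartitionedIVP ES EF) (uS : ℝ → ES) (uF : ℝ → EF) : Prop :=
  uS P.t₀ = P.initS ∧ uF P.t₀ = P.initF ∧
    SolvesODE P.full P.t₀ P.T (fun t => (uS t, uF t))

/-- `k` steps of size `h` of a one-step scheme, started at time `t₀` with value `z`. -/
def OneStep.steps {E : Type*} (Φ : OneStep E) (g : ℝ → E → E) (t₀ h : ℝ) (z : E) : ℕ → E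
  | 0 => z
  | k + 1 => Φ g (t₀ + k * h) h (Φ.steps g t₀ h z k)

/-- The ingredients of a spline-oriented multirate scheme with `m` micro steps per macro step:
basic schemes for the slow part, the fast part and the first macro step (full system), the
spline rule that is extrapolated for the fast part, and the rule that interpolates the slow part. -/
structure MultirateScheme (m : ℕ) (ES EF : Type*) where
  slow : OneStep ES
  fast : OneStep EF
  start : OneStep (ES × EF)
  extrap : SplineRule m EF
  interp : SplineRule 1 ES

/-- `N` macro steps of size `H` of the decoupled slowest-first multirate scheme, micro step size
`H / m`. Here `yS n` approximates the slow part at `t₀ + n * H`, `yF k` the fast part at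
`t₀ + k * (H / m)`. On the window `[t₀ + n * H, t₀ + (n + 1) * H]`, `n ≥ 1`, the function `wF n` is
the extrapolated fast waveform and `wS n` the interpolated slow waveform. -/
structure MultirateScheme.IsRun {m : ℕ} (A : MultirateScheme m ES EF) (P : PartitionedIVP ES EF)
    (H : ℝ) (N : ℕ) (yS : ℕ → ES) (yF : ℕ → EF) (wS : ℕ → ℝ → ES) (wF : ℕ → ℝ → EF) : Prop where
  init_slow : yS 0 = P.initS
  /-- First macro step: `m` micro steps of a single-rate scheme for the full system. -/
  first_fast : ∀ k ≤ m, yF k = (A.start.steps P.full P.t₀ (H / m) (P.initS, P.initF) k).2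
  first_slow : yS 1 = (A.start.steps P.full P.t₀ (H / m) (P.initS, P.initF) m).1
  /-- The fast waveform comes from the fast data of the previous window. -/
  extrapolate : ∀ n : ℕ, n + 2 ≤ N →
    A.extrap (P.t₀ + n * H) H (fun i => yF (n * m + i))
      (P.fF (P.t₀ + n * H) (yS n) (yF (n * m)))
      (P.fF (P.t₀ + (n + 1 : ℕ) * H) (yS (n + 1)) (yF ((n + 1) * m)))
      (wF (n + 1))
  slow_step : ∀ n : ℕ, n + 2 ≤ N →
    yS (n + 2) = A.slow (fun t x => P.fS t x (wF (n + 1) t)) (P.t₀ + (n + 1 : ℕ) * H) H (yS (n + 1))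
  /-- The slow waveform on the current window; the fast value at its right end is extrapolated. -/
  interpolate : ∀ n : ℕ, n + 2 ≤ N →
    A.interp (P.t₀ + (n + 1 : ℕ) * H) H ![yS (n + 1), yS (n + 2)]
      (P.fS (P.t₀ + (n + 1 : ℕ) * H) (yS (n + 1)) (yF ((n + 1) * m)))
      (P.fS (P.t₀ + (n + 2 : ℕ) * H) (yS (n + 2)) (wF (n + 1) (P.t₀ + (n + 2 : ℕ) * H)))
      (wS (n + 1))
  fast_steps : ∀ n : ℕ, n + 2 ≤ N → ∀ i < m,
    yF ((n + 1) * m + i + 1) =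
      A.fast (fun t x => P.fF t (wS (n + 1) t) x)
        (P.t₀ + (n + 1 : ℕ) * H + i * (H / m)) (H / m) (yF ((n + 1) * m + i))

/-- The scheme can be carried out for `N` macro steps of size `H`, and all macro and micro values
differ from the solution `(uS, uF)` by at most `ε`. -/
def MultirateScheme.ErrorAtMost {m : ℕ} (A : MultirateScheme m ES EF) (P : PartitionedIVP ES EF)
    (uS : ℝ → ES) (uF : ℝ → EF) (H : ℝ) (N : ℕ) (ε : ℝ) : Prop :=
  (∃ yS yF wS wF, A.IsRun P H N yS yF wS wF) ∧
    ∀ yS yF wS wF, A.IsRun P H N yS yF wS wF →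
      (∀ n ≤ N, ‖yS n - uS (P.t₀ + n * H)‖ ≤ ε) ∧
      ∀ k ≤ N * m, ‖yF k - uF (P.t₀ + k * (H / m))‖ ≤ ε

/-- Convergence, for all problems of class `C ^ k` that have a solution on `[t₀, T]`. -/
def MultirateScheme.IsConvergent {m : ℕ} (A : MultirateScheme m ES EF) (k : ℕ) : Prop :=
  ∀ (P : PartitionedIVP ES EF) (uS : ℝ → ES) (uF : ℝ → EF),
    P.t₀ < P.T → P.Smooth k → P.IsSolution uS uF →
    ∀ ε : ℝ, 0 < ε → ∃ H₀ : ℝ, 0 < H₀ ∧ ∀ (H : ℝ) (N : ℕ), 0 < H → H ≤ H₀ → 1 ≤ N →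
      P.t₀ + N * H ≤ P.T → A.ErrorAtMost P uS uF H N ε

/-- Convergence of order `r`, for all problems of class `C ^ k` that have a solution on
`[t₀, T]`. -/
def MultirateScheme.HasOrder {m : ℕ} (A : MultirateScheme m ES EF) (k r : ℕ) : Prop :=
  ∀ (P : PartitionedIVP ES EF) (uS : ℝ → ES) (uF : ℝ → EF),
    P.t₀ < P.T → P.Smooth k → P.IsSolution uS uF →
    ∃ C H₀ : ℝ, 0 < H₀ ∧ ∀ (H : ℝ) (N : ℕ), 0 < H → H ≤ H₀ → 1 ≤ N →
      P.t₀ + N * H ≤ P.T → A.ErrorAtMost P uS uF H N (C * H ^ r)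

end

/-! Let r = min(p, q). Everything rests on the stability recursion G(n+1) = (1 + cH) G(n), G(0) =
H^r, whose solution is at most exp(c(T - t₀)) H^r. It applies once a window is known to change each
error by at most cHG. Within a window the integrated component sees the other one only through a
waveform w, so the basic scheme acts on f(t, x, w(t)). The exact component solves this equation up
to a defect bounded by a Lipschitz constant times the waveform error, and polynomial reproduction
with Taylor's formula makes that error O(G + H^r). Order p of the basic scheme then gives the
increment bound (`OneStep.HasOrder.exists_steps_bound`, `exists_waveform_integration_bound`,
`exists_window_bound`).

The difficulty is uniformity. The constants of the basic schemes depend on derivatives of f(t, x,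
w(t)) up to order p, hence on derivatives of w, and the k-th derivative of w divides the errors of
the data by H^k. Data errors of size K H^r with K = exp(c(T - t₀)) would put K into these bounds,
although c itself depends on them. The circle is broken by looking at the variation of the error
inside a window. An error common to all nodes only shifts w by a constant. The variation is O(HG),
hence at most H^r with constant one as soon as cKH ≤ 1, and slope errors carry a factor H anyway. So
derivatives of order k ≤ min(p, q - 1) are bounded independently of K, and those of order k ≥ q
vanish because w is a polynomial of degree below q (`SplineRule.HasOrder.exists_waveform_bounds`).
The induction in `MultirateScheme.exists_error_le` carries the variation bound along with the error
bound.

For the clamped cubic rule it remains to see that its order is four. Uniqueness of the spline is the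
energy argument for the integral of s''², existence follows from uniqueness by counting dimensions
in the truncated power basis, and cubics are reproduced because a cubic is its own clamped spline.
-/

/-! ### One step of a basic scheme against a curve with small defect -/

section LocalStep

open Set Metric

variable {E : Type*} [NormedAddCommGroup E] [NormedSpace ℝ E]

/-- A right-hand side whose spatial derivative is bounded by `M` on a ball is `M`-Lipschitz there. -/
theorem lipschitzOnWith_of_norm_fderiv_uncurry_le {g : ℝ → E → E} {s M r : ℝ} {y : E}
    (hM : 0 ≤ M) (hg : Differentiable ℝ (fun z : ℝ × E => g z.1 z.2))
    (hbound : ∀ x, ‖x - y‖ ≤ r → ‖fderiv ℝ (fun z : ℝ × E => g z.1 z.2) (s, x)‖ ≤ M) :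
    LipschitzOnWith (Real.toNNReal M) (g s) (closedBall y r) := by
  have key : ∀ x, HasFDerivAt (g s)
      ((fderiv ℝ (fun z : ℝ × E => g z.1 z.2) (s, x)).comp (ContinuousLinearMap.inr ℝ ℝ E)) x :=
    fun x => ((hg (s, x)).hasFDerivAt).comp (f := fun x : E => (s, x)) x (hasFDerivAt_prodMk_right s x)
  refine (convex_closedBall y r).lipschitzOnWith_of_nnnorm_hasFDerivWithin_le
    (fun x _ => (key x).hasFDerivWithinAt) fun x hx => ?_
  rw [← NNReal.coe_le_coe, Real.coe_toNNReal M hM, coe_nnnorm]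
  refine (ContinuousLinearMap.opNorm_comp_le _ _).trans ?_
  have h1 := hbound x (by rwa [← mem_closedBall_iff_norm])
  have h2 := ContinuousLinearMap.norm_inr_le_one ℝ ℝ E
  nlinarith [norm_nonneg (ContinuousLinearMap.inr ℝ ℝ E)]

/-- Picard-Lindelöf with an explicit existence interval and containment in the unit ball. -/
theorem exists_solvesODE_mem_closedBall [CompleteSpace E] {g : ℝ → E → E} {t h M : ℝ} {y : E}
    (hM : 0 ≤ M) (hh : 0 < h) (hMh : M * h ≤ 1)
    (hg : Continuous (fun z : ℝ × E => g z.1 z.2))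
    (hbound : ∀ s ∈ Icc t (t + h), ∀ x ∈ closedBall y 1, ‖g s x‖ ≤ M)
    (hlip : ∀ s ∈ Icc t (t + h), LipschitzOnWith (Real.toNNReal M) (g s) (closedBall y 1)) :
    ∃ u : ℝ → E, u t = y ∧ SolvesODE g t (t + h) u ∧ ∀ s ∈ Icc t (t + h), u s ∈ closedBall y 1 := by
  have htm : t ∈ Icc t (t + h) := ⟨le_rfl, by linarith⟩
  have hp : IsPicardLindelof g (⟨t, htm⟩ : Icc t (t + h)) y 1 0 (Real.toNNReal M)
      (Real.toNNReal M) :=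
    { lipschitzOnWith := fun s hs => by simpa using hlip s hs
      continuousOn := fun x _ => (hg.comp (by fun_prop : Continuous fun s : ℝ => (s, x))).continuousOn
      norm_le := fun s hs x hx => by
        rw [Real.coe_toNNReal M hM]; exact hbound s hs x (by simpa using hx)
      mul_max_le := by
        rw [Real.coe_toNNReal M hM]
        simp only [add_sub_cancel_left, sub_self, NNReal.coe_one, NNReal.coe_zero, sub_zero]
        rwa [max_eq_left hh.le] }
  have hy : y ∈ closedBall y ((0 : NNReal) : ℝ) := by simp
  -- The fixed point of the Picard operator is used directly, since the space it lives in keeps the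
  -- curve inside the unit ball.
  obtain ⟨α, hα⟩ := ODE.FunSpace.exists_isFixedPt_next hp hy
  have hmem : ∀ s ∈ Icc t (t + h), α.compProj s ∈ closedBall y ((1 : NNReal) : ℝ) :=
    fun s _ => α.compProj_mem_closedBall hp.mul_max_le
  have heq : ∀ s ∈ Icc t (t + h), α.compProj s = ODE.picard g t y α.compProj s := by
    intro s hs
    conv_lhs => rw [← hα]
    rw [ODE.FunSpace.compProj_apply, ODE.FunSpace.next_apply, projIcc_of_mem _ hs]
  refine ⟨α.compProj, by simpa using heq t htm, fun s hs => ?_, by simpa using hmem⟩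
  exact (ODE.hasDerivWithinAt_picard_Icc htm hg.continuousOn
    (α.continuous_compProj).continuousOn (fun s _ => mem_univ (α.compProj s)) y hs).congr heq
    (heq s hs)

/-- Growth of the distance between a trajectory and an approximate trajectory over a short time. -/
theorem norm_sub_sub_le_of_approx_trajectory {g : ℝ → E → E} {t h M δ : ℝ} {u v v' : ℝ → E}
    {K : Set E} (hM : 0 ≤ M) (hh : 0 < h) (hMh : M * h ≤ 1 / 2) (h1 : h ≤ 1)
    (hlip : ∀ s ∈ Icc t (t + h), LipschitzOnWith (Real.toNNReal M) (g s) K)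
    (hu : SolvesODE g t (t + h) u)
    (hv : ∀ s ∈ Icc t (t + h), HasDerivWithinAt v (v' s) (Icc t (t + h)) s)
    (hδ : ∀ s ∈ Icc t (t + h), ‖v' s - g s (v s)‖ ≤ δ)
    (huK : ∀ s ∈ Icc t (t + h), u s ∈ K) (hvK : ∀ s ∈ Icc t (t + h), v s ∈ K) :
    ‖(u (t + h) - v (t + h)) - (u t - v t)‖ ≤ (2 * M + 1) * h * (‖u t - v t‖ + δ) := by
  have htm : t ∈ Icc t (t + h) := ⟨le_rfl, by linarith⟩
  have hthm : t + h ∈ Icc t (t + h) := ⟨by linarith, le_rfl⟩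
  have hδ0 : 0 ≤ δ := (norm_nonneg _).trans (hδ t htm)
  have hderiv : ∀ s ∈ Icc t (t + h), HasDerivWithinAt (fun s => u s - v s) (g s (u s) - v' s)
      (Icc t (t + h)) s := fun s hs => (hu s hs).sub (hv s hs)
  have hcont : ContinuousOn (fun s => u s - v s) (Icc t (t + h)) :=
    fun s hs => (hderiv s hs).continuousWithinAt
  -- In place of Gronwall's inequality: the mean value inequality bounds the maximum S by the
  -- initial distance plus (M S + δ) h, and M h ≤ 1/2 absorbs the term with S.
  obtain ⟨s₀, hs₀, hmax⟩ := isCompact_Icc.exists_isMaxOn ⟨t, htm⟩ hcont.norm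
  set S := ‖u s₀ - v s₀‖ with hS
  have hle : ∀ s ∈ Icc t (t + h), ‖u s - v s‖ ≤ S := fun s hs => hmax hs
  have hb : ∀ s ∈ Icc t (t + h), ‖g s (u s) - v' s‖ ≤ M * S + δ := by
    intro s hs
    have e1 := (hlip s hs).norm_sub_le (huK s hs) (hvK s hs)
    rw [Real.coe_toNNReal M hM] at e1
    have e2 := norm_sub_le_norm_sub_add_norm_sub (g s (u s)) (g s (v s)) (v' s)
    have e3 := hδ s hs
    rw [norm_sub_rev] at e3
    have e4 := mul_le_mul_of_nonneg_left (hle s hs) hM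
    linarith
  have mv : ∀ s ∈ Icc t (t + h), ‖(u s - v s) - (u t - v t)‖ ≤ (M * S + δ) * h := by
    intro s hs
    have := (convex_Icc t (t + h)).norm_image_sub_le_of_norm_hasDerivWithin_le hderiv hb htm hs
    refine this.trans ?_
    have hS0 : 0 ≤ S := norm_nonneg _
    gcongr
    rw [Real.norm_eq_abs, abs_of_nonneg] <;> linarith [hs.1, hs.2]
  have hS2 : S ≤ 2 * (‖u t - v t‖ + δ) := by
    have e1 := mv s₀ hs₀
    have e2 : S ≤ ‖(u s₀ - v s₀) - (u t - v t)‖ + ‖u t - v t‖ := norm_le_norm_sub_add _ _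
    have e3 : M * h * S ≤ 1 / 2 * S := by gcongr
    nlinarith
  refine (mv _ hthm).trans ?_
  nlinarith [mul_le_mul_of_nonneg_left hS2 (mul_nonneg hM hh.le), norm_nonneg (u t - v t)]

/-- One step of a scheme of order `p`, compared with a curve that satisfies the differential
equation up to a defect `δ`. -/
theorem OneStep.HasOrder.exists_step_bound [CompleteSpace E] {Φ : OneStep E} {p : ℕ} (hp : 1 ≤ p)
    (hΦ : Φ.HasOrder p) :
    ∃ κ : ℝ, 1 ≤ κ ∧ ∀ M : ℝ, ∃ C h₀ : ℝ, 0 ≤ C ∧ 0 < h₀ ∧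
      ∀ (g : ℝ → E → E) (t h δ : ℝ) (y : E) (v v' : ℝ → E),
        0 < h → h ≤ h₀ → ContDiff ℝ p (fun z : ℝ × E => g z.1 z.2) →
        (∀ k ≤ p, ∀ s x, |s - t| ≤ κ * h → ‖x - y‖ ≤ 1 →
          ‖iteratedFDeriv ℝ k (fun z : ℝ × E => g z.1 z.2) (s, x)‖ ≤ M) →
        (∀ s ∈ Icc t (t + h), HasDerivWithinAt v (v' s) (Icc t (t + h)) s) →
        (∀ s ∈ Icc t (t + h), ‖v' s - g s (v s)‖ ≤ δ) →
        (∀ s ∈ Icc t (t + h), ‖v s - y‖ ≤ 1) →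
        ‖(Φ g t h y - v (t + h)) - (y - v t)‖ ≤ C * h * (‖y - v t‖ + δ + h ^ p) := by
  obtain ⟨κ, hκ, H⟩ := hΦ
  refine ⟨κ, hκ, fun M => ?_⟩
  obtain ⟨C, h₀, hh₀, hC⟩ := H 1 one_pos M
  set M' := max M 0
  have hM' : 0 ≤ M' := le_max_right _ _
  -- The term |C| pays for the local error and 2 M' + 1 for the separation of the local solution
  -- from `v`. The step bound forces both h ≤ 1 and M' h ≤ 1/2.
  refine ⟨|C| + (2 * M' + 1), min h₀ (1 / (2 * M' + 1) / 2), by positivity, by positivity, ?_⟩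
  intro g t h δ y v v' hh hle hg hbd hv hδ hvy
  have hle₀ : h ≤ h₀ := hle.trans (min_le_left _ _)
  have hle₁ : h ≤ 1 / (2 * M' + 1) / 2 := hle.trans (min_le_right _ _)
  rw [div_div, le_div_iff₀ (by positivity)] at hle₁
  have hh1 : h ≤ 1 := by nlinarith
  have hMh : M' * h ≤ 1 / 2 := by nlinarith
  have hs_abs : ∀ s ∈ Icc t (t + h), |s - t| ≤ κ * h := by
    intro s hs
    rw [abs_of_nonneg (by linarith [hs.1])]
    nlinarith [hs.2]
  have hdiff : Differentiable ℝ (fun z : ℝ × E => g z.1 z.2) :=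
    hg.differentiable (by exact_mod_cast (by lia : p ≠ 0))
  have hlip : ∀ s ∈ Icc t (t + h), LipschitzOnWith (Real.toNNReal M') (g s) (closedBall y 1) := by
    intro s hs
    refine lipschitzOnWith_of_norm_fderiv_uncurry_le hM' hdiff fun x hx => ?_
    have := hbd 1 hp s x (hs_abs s hs) hx
    rw [norm_iteratedFDeriv_one] at this
    exact this.trans (le_max_left _ _)
  have hnorm : ∀ s ∈ Icc t (t + h), ∀ x ∈ closedBall y 1, ‖g s x‖ ≤ M' := by
    intro s hs x hx
    have := hbd 0 (Nat.zero_le _) s x (hs_abs s hs) (by rwa [← mem_closedBall_iff_norm])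
    rw [norm_iteratedFDeriv_zero] at this
    exact this.trans (le_max_left _ _)
  obtain ⟨u, hut, hu, humem⟩ := exists_solvesODE_mem_closedBall hM' hh (by linarith)
    hg.continuous hnorm hlip
  have e1 := hC g t h y u hh hle₀ hg hbd hu hut
  have e2 := norm_sub_sub_le_of_approx_trajectory hM' hh hMh hh1 hlip hu hv hδ humem
    (fun s hs => by rw [mem_closedBall_iff_norm]; exact hvy s hs)
  rw [hut] at e2
  have hδ0 : 0 ≤ δ := (norm_nonneg _).trans (hδ t ⟨le_rfl, by linarith⟩)
  have e3 : (Φ g t h y - v (t + h)) - (y - v t)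
      = (Φ g t h y - u (t + h)) + ((u (t + h) - v (t + h)) - (y - v t)) := by abel
  rw [e3]
  refine (norm_add_le _ _).trans ?_
  have e4 : C * h ^ (p + 1) ≤ |C| * h * h ^ p := by
    rw [pow_succ', ← mul_assoc]; gcongr; exact le_abs_self C
  have e5 : 0 ≤ |C| * h * (‖y - v t‖ + δ) := by positivity
  have e6 : 0 ≤ (2 * M' + 1) * h * h ^ p := by positivity
  linarith [e1, e2, e4, e5, e6, mul_add (|C| * h) (‖y - v t‖ + δ) (h ^ p),
    mul_add ((2 * M' + 1) * h) (‖y - v t‖ + δ) (h ^ p),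
    add_mul |C| (2 * M' + 1) h, add_mul (|C| * h) ((2 * M' + 1) * h) (‖y - v t‖ + δ + h ^ p)]

end LocalStep

/-! ### Several steps: bounds for the change of the error -/

section MultiStep

open Set Metric

variable {E : Type*} [NormedAddCommGroup E] [NormedSpace ℝ E]

/-- Up to `m` steps of a scheme of order `p`, compared with a curve that satisfies the differential
equation up to a defect `δ`. -/
theorem OneStep.HasOrder.exists_steps_bound [CompleteSpace E] {Φ : OneStep E} {p : ℕ} (hp : 1 ≤ p)
    (hΦ : Φ.HasOrder p) (m : ℕ) :
    ∃ κ : ℝ, 1 ≤ κ ∧ ∀ M : ℝ, ∃ C h₀ : ℝ, 0 ≤ C ∧ 0 < h₀ ∧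
      ∀ (g : ℝ → E → E) (t h δ : ℝ) (y : E) (v v' : ℝ → E),
        0 < h → h ≤ h₀ → ContDiff ℝ p (fun z : ℝ × E => g z.1 z.2) →
        (∀ k ≤ p, ∀ s x, |s - t| ≤ κ * h → ‖x - v t‖ ≤ 2 →
          ‖iteratedFDeriv ℝ k (fun z : ℝ × E => g z.1 z.2) (s, x)‖ ≤ M) →
        (∀ s ∈ Icc t (t + m * h), HasDerivWithinAt v (v' s) (Icc t (t + m * h)) s) →
        (∀ s ∈ Icc t (t + m * h), ‖v' s - g s (v s)‖ ≤ δ) →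
        (∀ s ∈ Icc t (t + m * h), ‖v s - v t‖ ≤ 1 / 8) →
        ‖y - v t‖ ≤ 1 / 8 → δ ≤ 1 / 8 →
        ∀ i ≤ m, ‖(Φ.steps g t h y i - v (t + i * h)) - (y - v t)‖
          ≤ C * (i * h) * (‖y - v t‖ + δ + h ^ p) := by
  obtain ⟨κ, hκ, H⟩ := hΦ.exists_step_bound hp
  -- The i-th step starts i h later and looks κ h around its own start, so κ + m covers all of them
  -- as seen from t.
  refine ⟨κ + m, by linarith [(Nat.cast_nonneg m : (0 : ℝ) ≤ m)], fun M => ?_⟩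
  obtain ⟨C, h₀, hC0, hh₀, hC⟩ := H M
  -- The factor 2 allows the quantity entering a step to be twice the initial one. The step bound
  -- gives 8 C m h ≤ 1, so this doubling is never exceeded.
  refine ⟨2 * C, min h₀ (1 / (8 * (C * m + 1))), by positivity, by positivity, ?_⟩
  intro g t h δ y v v' hh hle hg hbd hv hδ hosc hy hδ8 i
  have hle₀ : h ≤ h₀ := hle.trans (min_le_left _ _)
  have hle₁ : h ≤ 1 / (8 * (C * m + 1)) := hle.trans (min_le_right _ _)
  have hCm : 0 ≤ C * m := by positivity
  rw [le_div_iff₀ (by positivity)] at hle₁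
  have hh8 : h ≤ 1 / 8 := by nlinarith
  have hCmh : 8 * (C * (m * h)) ≤ 1 := by nlinarith
  have hhp : h ^ p ≤ 1 / 8 := (pow_le_of_le_one hh.le (by linarith) (by lia)).trans hh8
  have hhp0 : 0 ≤ h ^ p := by positivity
  have hmh : (0 : ℝ) ≤ m * h := by positivity
  have hδ0 : 0 ≤ δ := (norm_nonneg _).trans (hδ t ⟨le_rfl, by linarith⟩)
  have hmemnode : ∀ j ≤ m, t + j * h ∈ Icc t (t + m * h) := by
    intro j hj
    have : (j : ℝ) ≤ m := by exact_mod_cast hj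
    exact ⟨by nlinarith [(Nat.cast_nonneg j : (0 : ℝ) ≤ j)], by nlinarith⟩
  set a := ‖y - v t‖ + δ + h ^ p with ha
  have ha0 : 0 ≤ a := by positivity
  induction i with
  | zero => intro _; simp [OneStep.steps]
  | succ i ih =>
    intro hi
    have ih := ih (by lia)
    have him : (i : ℝ) + 1 ≤ m := by exact_mod_cast hi
    set yi := Φ.steps g t h y i with hyi
    set ti := t + i * h with hti
    have hi0 : (0 : ℝ) ≤ i := Nat.cast_nonneg i
    have htsub : Icc ti (ti + h) ⊆ Icc t (t + m * h) := by
      refine Icc_subset_Icc (by rw [hti]; nlinarith) ?_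
      rw [hti]; nlinarith
    have hti_mem := hmemnode i (by lia)
    have hih : C * (i * h) ≤ C * (m * h) := by gcongr; linarith
    -- Since a ≤ 3/8, this also keeps the unit ball around the current value inside the ball of
    -- radius 2 around `v t`, where the derivative bounds hold.
    have hdev : ‖(yi - v ti) - (y - v t)‖ ≤ a / 2 := by
      refine ih.trans ?_
      nlinarith [mul_nonneg hC0 (mul_nonneg hi0 hh.le)]
    have hei : ‖yi - v ti‖ ≤ ‖y - v t‖ + a / 2 := by
      linarith [norm_le_norm_sub_add (yi - v ti) (y - v t)]
    have hosci := hosc ti hti_mem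
    have step := hC g ti h δ yi v v' hh hle₀ hg ?_ ?_ ?_ ?_
    · have e1 : Φ.steps g t h y (i + 1) = Φ g ti h yi := rfl
      have e2 : t + ((i + 1 : ℕ) : ℝ) * h = ti + h := by push_cast; rw [hti]; ring
      rw [e1, e2]
      have e3 : (Φ g ti h yi - v (ti + h)) - (y - v t)
          = ((Φ g ti h yi - v (ti + h)) - (yi - v ti)) + ((yi - v ti) - (y - v t)) := by abel
      rw [e3]
      refine (norm_add_le _ _).trans ?_
      have e4 : ‖yi - v ti‖ + δ + h ^ p ≤ 2 * a := by linarith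
      have e5 : C * h * (‖yi - v ti‖ + δ + h ^ p) ≤ C * h * (2 * a) := by gcongr
      push_cast
      linarith
    · intro k hk s x hs hx
      refine hbd k hk s x ?_ ?_
      · have : |s - t| ≤ |s - ti| + i * h := by
          have := abs_add_le (s - ti) (ti - t)
          rw [show s - ti + (ti - t) = s - t by ring] at this
          rwa [show ti - t = i * h by rw [hti]; ring, abs_of_nonneg (mul_nonneg hi0 hh.le)] at this
        nlinarith
      · have e1 : x - v t = (x - yi) + (yi - v ti) + (v ti - v t) := by abel
        rw [e1]
        have := norm_add₃_le (a := x - yi) (b := yi - v ti) (c := v ti - v t)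
        linarith
    · intro s hs; exact (hv s (htsub hs)).mono htsub
    · intro s hs; exact hδ s (htsub hs)
    · intro s hs
      have e1 : v s - yi = (v s - v t) + (v t - v ti) + (v ti - yi) := by abel
      rw [e1]
      have := norm_add₃_le (a := v s - v t) (b := v t - v ti) (c := v ti - yi)
      rw [norm_sub_rev (v t), norm_sub_rev (v ti) yi] at this
      linarith [hosc s (htsub hs)]

end MultiStep

/-! ### Derivative bounds for right-hand sides with an inserted waveform -/

section Composition

open Set Metric

/-- The derivatives up to order `p` of a `C ^ p` function are bounded on balls. -/
theorem ContDiff.exists_norm_iteratedFDeriv_le {F G : Type*} [NormedAddCommGroup F]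
    [NormedSpace ℝ F] [ProperSpace F] [NormedAddCommGroup G] [NormedSpace ℝ G] {f : F → G} {p : ℕ}
    (hf : ContDiff ℝ p f) (R : ℝ) :
    ∃ B : ℝ, 0 ≤ B ∧ ∀ k ≤ p, ∀ x, ‖x‖ ≤ R → ‖iteratedFDeriv ℝ k f x‖ ≤ B := by
  have h : ∀ k : ℕ, ∃ B : ℝ, k ≤ p → ∀ x ∈ closedBall (0 : F) R, ‖iteratedFDeriv ℝ k f x‖ ≤ B := by
    intro k
    by_cases hk : k ≤ p
    · obtain ⟨B, hB⟩ := (isCompact_closedBall (0 : F) R).exists_bound_of_continuousOn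
        (hf.continuous_iteratedFDeriv (by exact_mod_cast hk : (k : WithTop ℕ∞) ≤ p)).continuousOn
      exact ⟨B, fun _ => hB⟩
    · exact ⟨0, fun h => absurd h hk⟩
  choose B hB using h
  refine ⟨∑ k ∈ Finset.range (p + 1), |B k|, Finset.sum_nonneg fun _ _ => abs_nonneg _,
    fun k hk x hx => ?_⟩
  refine (hB k hk x (by simpa using hx)).trans ((le_abs_self _).trans ?_)
  exact Finset.single_le_sum (f := fun k => |B k|) (fun _ _ => abs_nonneg _)
    (Finset.mem_range.2 (by lia))

/-- A `C ^ 1` function is Lipschitz on balls. -/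
theorem ContDiff.exists_norm_sub_le_mul {F G : Type*} [NormedAddCommGroup F]
    [NormedSpace ℝ F] [ProperSpace F] [NormedAddCommGroup G] [NormedSpace ℝ G] {f : F → G} {p : ℕ}
    (hp : 1 ≤ p) (hf : ContDiff ℝ p f) (R : ℝ) :
    ∃ L : ℝ, 0 ≤ L ∧ ∀ x y, ‖x‖ ≤ R → ‖y‖ ≤ R → ‖f x - f y‖ ≤ L * ‖x - y‖ := by
  obtain ⟨K, hK⟩ := (hf.contDiffOn (s := closedBall 0 R)).exists_lipschitzOnWith
    (by exact_mod_cast (by lia : p ≠ 0)) (convex_closedBall _ _) (isCompact_closedBall _ _)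
  exact ⟨K, K.2, fun x y hx hy => hK.norm_sub_le (by simpa using hx) (by simpa using hy)⟩

/-- Uniform bounds for the derivatives of `(s, x) ↦ f (L (s, x) + J (w s))` in terms of bounds for
the derivatives of `w`. -/
theorem ContDiff.exists_norm_iteratedFDeriv_comp_waveform_le {E E' F G : Type*}
    [NormedAddCommGroup E] [NormedSpace ℝ E] [NormedAddCommGroup E'] [NormedSpace ℝ E']
    [NormedAddCommGroup F] [NormedSpace ℝ F] [ProperSpace F] [NormedAddCommGroup G]
    [NormedSpace ℝ G] {f : F → G} {p : ℕ} (hf : ContDiff ℝ p f) (L : ℝ × E →L[ℝ] F)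
    (J : E' →L[ℝ] F) (R W : ℝ) :
    ∃ M : ℝ, ∀ (w : ℝ → E') (s : ℝ) (x : E), ContDiff ℝ p w → ‖L (s, x) + J (w s)‖ ≤ R →
      (∀ i ≤ p, ‖iteratedDeriv i w s‖ ≤ W) →
      ∀ k ≤ p, ‖iteratedFDeriv ℝ k (fun z : ℝ × E => f (L z + J (w z.1))) (s, x)‖ ≤ M := by
  obtain ⟨B, hB0, hB⟩ := hf.exists_norm_iteratedFDeriv_le R
  -- Every derivative of the inner map of order 1 to p is bounded by ‖L‖ + ‖J‖ |W|. The added 1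
  -- makes D ≥ 1, so the bound weakens to D ^ i, the form required by the estimate for higher
  -- derivatives of a composition.
  set D := ‖L‖ + ‖J‖ * |W| + 1 with hD
  have hD1 : 1 ≤ D := by rw [hD]; linarith [norm_nonneg L, mul_nonneg (norm_nonneg J) (abs_nonneg W)]
  refine ⟨(p.factorial : ℝ) * B * D ^ p, fun w s x hw hR hW k hk => ?_⟩
  have hwz : ContDiff ℝ p (fun z : ℝ × E => w z.1) := hw.comp contDiff_fst
  have hJw : ContDiff ℝ p (fun z : ℝ × E => J (w z.1)) := J.contDiff.comp hwz
  have hψ : ContDiff ℝ p (fun z : ℝ × E => L z + J (w z.1)) := L.contDiff.add hJw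
  have hinner : ∀ i, 1 ≤ i → i ≤ p →
      ‖iteratedFDeriv ℝ i (fun z : ℝ × E => L z + J (w z.1)) (s, x)‖ ≤ D ^ i := by
    intro i hi hip
    have hip' : (i : WithTop ℕ∞) ≤ p := by exact_mod_cast hip
    have e1 : ‖iteratedFDeriv ℝ i (fun z : ℝ × E => w z.1) (s, x)‖ ≤ |W| := by
      have h1 := ContinuousLinearMap.iteratedFDeriv_comp_right (ContinuousLinearMap.fst ℝ ℝ E)
        hw (s, x) hip'
      have h2 : (w ∘ ⇑(ContinuousLinearMap.fst ℝ ℝ E)) = fun z : ℝ × E => w z.1 := rfl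
      rw [h2] at h1
      rw [h1]
      refine (ContinuousMultilinearMap.norm_compContinuousLinearMap_le _ _).trans ?_
      have h3 : ∏ _j : Fin i, ‖ContinuousLinearMap.fst ℝ ℝ E‖ ≤ 1 :=
        Finset.prod_le_one (fun _ _ => norm_nonneg _)
          fun _ _ => ContinuousLinearMap.norm_fst_le ℝ ℝ E
      have h4 : ‖iteratedFDeriv ℝ i w s‖ ≤ W := by
        rw [norm_iteratedFDeriv_eq_norm_iteratedDeriv]; exact hW i hip
      calc _ ≤ W * 1 := mul_le_mul h4 h3 (Finset.prod_nonneg fun _ _ => norm_nonneg _)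
              ((norm_nonneg _).trans h4)
        _ ≤ |W| := by rw [mul_one]; exact le_abs_self W
    have e2 : ‖iteratedFDeriv ℝ i (fun z : ℝ × E => J (w z.1)) (s, x)‖ ≤ ‖J‖ * |W| :=
      (J.norm_iteratedFDeriv_comp_left hwz.contDiffAt hip').trans (by gcongr)
    have e3 : ‖iteratedFDeriv ℝ i (fun z : ℝ × E => L z) (s, x)‖ ≤ ‖L‖ := by
      obtain ⟨j, rfl⟩ : ∃ j, i = j + 1 := ⟨i - 1, by lia⟩
      have h1 : fderiv ℝ (fun z : ℝ × E => L z) = fun _ => L := funext fun z => L.fderiv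
      rw [← norm_iteratedFDeriv_fderiv, h1]
      rcases Nat.eq_zero_or_pos j with rfl | hj
      · rw [norm_iteratedFDeriv_zero]
      · rw [iteratedFDeriv_const_of_ne (by lia)]
        simp
    have e4 : iteratedFDeriv ℝ i (fun z : ℝ × E => L z + J (w z.1)) (s, x)
        = iteratedFDeriv ℝ i (fun z : ℝ × E => L z) (s, x)
          + iteratedFDeriv ℝ i (fun z : ℝ × E => J (w z.1)) (s, x) :=
      iteratedFDeriv_add_apply (L.contDiff.of_le le_top).contDiffAt (hJw.of_le hip').contDiffAt
    rw [e4]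
    refine (norm_add_le _ _).trans (le_trans ?_ (le_self_pow₀ hD1 (by lia)))
    linarith
  have hkp' : (k : WithTop ℕ∞) ≤ p := by exact_mod_cast hk
  refine (norm_iteratedFDeriv_comp_le hf hψ hkp' (s, x) (C := B) (D := D)
    (fun i hi => hB i (hi.trans hk) _ hR) fun i hi hik => hinner i hi (hik.trans hk)).trans ?_
  gcongr

end Composition

/-! ### Spline waveforms: error and derivatives -/

section Waveform

open Set Polynomial

variable {E : Type*} [NormedAddCommGroup E] [NormedSpace ℝ E]

theorem hasDerivAt_eval_div_smul (P : ℝ[X]) (a H : ℝ) (ζ : E) (s : ℝ) :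
    HasDerivAt (fun s => P.eval ((s - a) / H) • ζ) ((derivative P).eval ((s - a) / H) • H⁻¹ • ζ) s := by
  have h1 : HasDerivAt (fun s : ℝ => (s - a) / H) (1 / H) s :=
    ((hasDerivAt_id s).sub_const a).div_const H
  have h2 := ((P.hasDerivAt ((s - a) / H)).comp s h1).smul_const ζ
  simpa [mul_smul, Function.comp_def] using h2

theorem contDiff_eval_div_smul (P : ℝ[X]) (a H : ℝ) (ζ : E) {n : WithTop ℕ∞} :
    ContDiff ℝ n (fun s => P.eval ((s - a) / H) • ζ) := by
  have h1 : ContDiff ℝ n (fun s : ℝ => (s - a) / H) := by fun_prop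
  have h2 : ContDiff ℝ n (fun θ : ℝ => P.eval θ) := by
    have h3 := contDiff_aeval (𝕜 := ℝ) P n
    simp only [coe_aeval_eq_eval] at h3
    exact h3
  exact (h2.comp h1).smul contDiff_const

theorem iteratedDeriv_eval_div_smul (a H : ℝ) (k : ℕ) (P : ℝ[X]) (ζ : E) :
    iteratedDeriv k (fun s => P.eval ((s - a) / H) • ζ)
      = fun s => (derivative^[k] P).eval ((s - a) / H) • (H⁻¹ ^ k) • ζ := by
  induction k generalizing P ζ with
  | zero => simp
  | succ k ih =>
    have h1 : deriv (fun s => P.eval ((s - a) / H) • ζ)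
        = fun s => (derivative P).eval ((s - a) / H) • H⁻¹ • ζ :=
      funext fun s => (hasDerivAt_eval_div_smul P a H ζ s).deriv
    rw [iteratedDeriv_succ', h1, ih]
    funext s
    rw [Function.iterate_succ_apply, smul_smul (H⁻¹ ^ k), pow_succ]

theorem iteratedDeriv_sum_eval_div_smul {ι : Type*} [Fintype ι] (a H : ℝ) (k : ℕ) (ψ : ι → ℝ[X])
    (ζ : ι → E) (s : ℝ) :
    iteratedDeriv k (fun s => ∑ j, (ψ j).eval ((s - a) / H) • ζ j) s
      = ∑ j, (derivative^[k] (ψ j)).eval ((s - a) / H) • (H⁻¹ ^ k) • ζ j := by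
  rw [iteratedDeriv_fun_sum fun j _ => (contDiff_eval_div_smul (ψ j) a H (ζ j)).contDiffAt]
  exact Finset.sum_congr rfl fun j _ => congrFun (iteratedDeriv_eval_div_smul a H k (ψ j) (ζ j)) s

theorem Polynomial.exists_abs_eval_iterate_derivative_le {ι : Type*} [Fintype ι] (ψ : ι → ℝ[X])
    (N : ℕ) (κ : ℝ) :
    ∃ A : ℝ, 0 ≤ A ∧ ∀ k ≤ N, ∀ θ, |θ| ≤ κ → ∑ j, |(derivative^[k] (ψ j)).eval θ| ≤ A := by
  have h : ∀ k : ℕ, ∃ B : ℝ, ∀ θ ∈ Icc (-κ) κ, ‖∑ j, |(derivative^[k] (ψ j)).eval θ|‖ ≤ B :=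
    fun k => isCompact_Icc.exists_bound_of_continuousOn (by fun_prop)
  choose B hB using h
  refine ⟨∑ k ∈ Finset.range (N + 1), |B k|, Finset.sum_nonneg fun _ _ => abs_nonneg _,
    fun k hk θ hθ => ?_⟩
  refine (le_abs_self _).trans ((hB k θ (abs_le.1 hθ)).trans ((le_abs_self _).trans ?_))
  exact Finset.single_le_sum (f := fun k => |B k|) (fun _ _ => abs_nonneg _)
    (Finset.mem_range.2 (by lia))

/-- Each differentiation costs a factor 1/H. Derivatives therefore stay bounded as H → 0 only when
the data are O(H^k), which is why the spline is later applied to residual data. -/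
theorem norm_iteratedDeriv_sum_eval_div_smul_le {ι : Type*} [Fintype ι] {ψ : ι → ℝ[X]} {N : ℕ}
    {κ A : ℝ} (hA : ∀ k ≤ N, ∀ θ, |θ| ≤ κ → ∑ j, |(derivative^[k] (ψ j)).eval θ| ≤ A)
    {a H τ : ℝ} (hH : 0 < H) {ζ : ι → E} (hτ : 0 ≤ τ) (hζ : ∀ j, ‖ζ j‖ ≤ τ) {k : ℕ} (hk : k ≤ N)
    {s : ℝ} (hs : |s - a| ≤ κ * H) :
    ‖iteratedDeriv k (fun s => ∑ j, (ψ j).eval ((s - a) / H) • ζ j) s‖ ≤ A * (H⁻¹ ^ k * τ) := by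
  rw [iteratedDeriv_sum_eval_div_smul]
  have hθ : |(s - a) / H| ≤ κ := by rwa [abs_div, abs_of_pos hH, div_le_iff₀ hH]
  have hHk : 0 ≤ H⁻¹ ^ k := by positivity
  refine (norm_sum_le _ _).trans ?_
  calc ∑ j, ‖(derivative^[k] (ψ j)).eval ((s - a) / H) • (H⁻¹ ^ k) • ζ j‖
      ≤ ∑ j, |(derivative^[k] (ψ j)).eval ((s - a) / H)| * (H⁻¹ ^ k * τ) := by
        refine Finset.sum_le_sum fun j _ => ?_
        rw [norm_smul, norm_smul, Real.norm_eq_abs, Real.norm_eq_abs, abs_of_nonneg hHk]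
        gcongr
        exact hζ j
    _ ≤ A * (H⁻¹ ^ k * τ) := by
        rw [← Finset.sum_mul]
        exact mul_le_mul_of_nonneg_right (hA k hk _ hθ) (mul_nonneg hHk hτ)

/-- Taylor's formula along a chain of derivatives on an interval. -/
theorem norm_sub_taylor_sum_le {t₀ T B : ℝ} {a s : ℝ} (ha : a ∈ Icc t₀ T) (hs : s ∈ Icc t₀ T)
    (n : ℕ) (D : ℕ → ℝ → E)
    (hD : ∀ k < n, ∀ t ∈ Icc t₀ T, HasDerivWithinAt (D k) (D (k + 1) t) (Icc t₀ T) t)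
    (hB : ∀ t ∈ Icc t₀ T, ‖D n t‖ ≤ B) :
    ‖D 0 s - ∑ k ∈ Finset.range n, (s - a) ^ k • ((k.factorial : ℝ)⁻¹ • D k a)‖
      ≤ B * |s - a| ^ n := by
  have hB0 : 0 ≤ B := (norm_nonneg _).trans (hB a ha)
  induction n generalizing D s with
  | zero => simpa using hB s hs
  | succ n ih =>
    have hsub : uIcc a s ⊆ Icc t₀ T := uIcc_subset_Icc ha hs
    -- The derivative of this remainder is the remainder, one order lower, of the shifted chain. The
    -- mean value inequality then gains one power of |s - a|, with no attempt to keep the factorial.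
    set g' : ℝ → E := fun x =>
      D 1 x - ∑ k ∈ Finset.range n, (x - a) ^ k • ((k.factorial : ℝ)⁻¹ • D (k + 1) a) with hg'
    have hder : ∀ x ∈ uIcc a s, HasDerivWithinAt
        (fun x => D 0 x - ∑ k ∈ Finset.range (n + 1), (x - a) ^ k • ((k.factorial : ℝ)⁻¹ • D k a))
        (g' x) (uIcc a s) x := by
      intro x hx
      refine ((hD 0 (by lia) x (hsub hx)).mono hsub).sub ?_
      simp only [Finset.sum_range_succ' _ n, pow_zero]
      have h0 : ∀ k ∈ Finset.range n, HasDerivWithinAt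
          (fun x : ℝ => (x - a) ^ (k + 1) • (((k + 1).factorial : ℝ)⁻¹ • D (k + 1) a))
          ((x - a) ^ k • ((k.factorial : ℝ)⁻¹ • D (k + 1) a)) (uIcc a s) x := by
        intro k _
        have h1 : HasDerivAt (fun x : ℝ => (x - a) ^ (k + 1)) ((k + 1 : ℕ) * (x - a) ^ k) x := by
          simpa using ((hasDerivAt_id x).sub_const a).fun_pow (k + 1)
        have h2 := (h1.smul_const (((k + 1).factorial : ℝ)⁻¹ • D (k + 1) a)).hasDerivWithinAt
          (s := uIcc a s)
        refine h2.congr_deriv ?_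
        rw [smul_smul, smul_smul]
        congr 1
        rw [Nat.factorial_succ]
        push_cast
        have : (k.factorial : ℝ) ≠ 0 := by positivity
        have : (k : ℝ) + 1 ≠ 0 := by positivity
        field_simp
      have h3 := (HasDerivWithinAt.fun_sum h0).add_const ((1 : ℝ) • ((Nat.factorial 0 : ℝ)⁻¹ • D 0 a))
      exact h3
    have hbd : ∀ x ∈ uIcc a s, ‖g' x‖ ≤ B * |s - a| ^ n := by
      intro x hx
      have h1 := ih (hsub hx) (fun k => D (k + 1))
        (fun k hk t ht => hD (k + 1) (by lia) t ht) hB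
      refine h1.trans ?_
      exact mul_le_mul_of_nonneg_left (pow_le_pow_left₀ (abs_nonneg _)
        (abs_sub_left_of_mem_uIcc hx) n) hB0
    have := (convex_uIcc a s).norm_image_sub_le_of_norm_hasDerivWithin_le hder hbd left_mem_uIcc
      right_mem_uIcc
    have hz : D 0 a - ∑ k ∈ Finset.range (n + 1), (a - a) ^ k • ((k.factorial : ℝ)⁻¹ • D k a) = 0 := by
      simp [Finset.sum_range_succ']
    rw [hz, sub_zero, Real.norm_eq_abs] at this
    rwa [pow_succ, ← mul_assoc]

/-- Reproduction of polynomials with vector-valued coefficients on an arbitrary window. -/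
theorem spline_reproduces {m n q : ℕ} (hnq : n < q) {ω : Fin (m + 1) → ℝ[X]} {δ₀ δ₁ : ℝ[X]}
    (hrep : ∀ P : ℝ[X], P.degree < q → ∀ θ : ℝ,
      ∑ i : Fin (m + 1), (ω i).eval θ * P.eval ((i : ℝ) / m)
        + δ₀.eval θ * P.derivative.eval 0 + δ₁.eval θ * P.derivative.eval 1 = P.eval θ)
    {a H : ℝ} (hH : 0 < H) (c : ℕ → E) (s : ℝ) :
    ∑ i : Fin (m + 1), (ω i).eval ((s - a) / H) •
        ∑ k ∈ Finset.range (n + 1), (a + (i : ℝ) * (H / m) - a) ^ k • c k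
      + H • (δ₀.eval ((s - a) / H) • ∑ k ∈ Finset.range n, (a - a) ^ k • ((k : ℝ) + 1) • c (k + 1)
        + δ₁.eval ((s - a) / H) •
          ∑ k ∈ Finset.range n, (a + H - a) ^ k • ((k : ℝ) + 1) • c (k + 1))
      = ∑ k ∈ Finset.range (n + 1), (s - a) ^ k • c k := by
  set θ := (s - a) / H with hθ
  have hsa : s - a = θ * H := by rw [hθ]; field_simp
  -- Only monomials need testing: the rule is linear, so vector coefficients can be treated one
  -- power at a time.
  have hk : ∀ k < q, ∑ i : Fin (m + 1), (ω i).eval θ * ((i : ℝ) / m) ^ k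
      + δ₀.eval θ * (k * 0 ^ (k - 1)) + δ₁.eval θ * k = θ ^ k := by
    intro k hk
    have := hrep (X ^ k) (by rw [degree_X_pow]; exact_mod_cast hk) θ
    simpa [derivative_X_pow] using this
  have key : ∀ k ∈ Finset.range n,
      ∑ i : Fin (m + 1), (ω i).eval θ • (a + (i : ℝ) * (H / m) - a) ^ (k + 1) • c (k + 1)
      + H • (δ₀.eval θ • (a - a) ^ k • ((k : ℝ) + 1) • c (k + 1)
        + δ₁.eval θ • (a + H - a) ^ k • ((k : ℝ) + 1) • c (k + 1))
      = (s - a) ^ (k + 1) • c (k + 1) := by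
    intro k hkn
    have h1 := hk (k + 1) (by have := Finset.mem_range.1 hkn; lia)
    simp only [smul_smul, ← Finset.sum_smul, ← add_smul]
    congr 1
    rw [hsa, mul_pow, ← h1]
    simp only [add_sub_cancel_left, sub_self, Nat.add_sub_cancel, add_mul, Finset.sum_mul]
    push_cast
    -- With 0 ^ 0 = 1, the left slope sees the linear monomial only; for larger k both sides vanish.
    have h2 : H * ((0 : ℝ) ^ k) = 0 ^ k * H ^ (k + 1) := by
      rcases k with _ | k
      · simp
      · simp
    have h3 : ∀ i : Fin (m + 1), eval θ (ω i) * (↑↑i * (H / ↑m)) ^ (k + 1)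
        = eval θ (ω i) * ((i : ℝ) / m) ^ (k + 1) * H ^ (k + 1) := by
      intro i
      rw [mul_assoc, ← mul_pow]
      ring_nf
    rw [Finset.sum_congr rfl fun i _ => h3 i]
    linear_combination (δ₀.eval θ * ((k : ℝ) + 1)) * h2
  have h0 := hk 0 (by lia)
  simp only [pow_zero, mul_one, Nat.cast_zero, zero_mul, mul_zero, add_zero] at h0
  rw [Finset.sum_range_succ', ← Finset.sum_congr rfl key]
  simp only [Finset.sum_range_succ' _ n, pow_zero, one_smul, smul_add, Finset.smul_sum,
    Finset.sum_add_distrib, ← Finset.sum_smul, h0]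
  rw [Finset.sum_comm]
  abel

/-- Representation of a spline waveform as a polynomial plus the spline of the residual data. -/
theorem spline_eq_taylor_add {m n q : ℕ} (hnq : n < q) {ω : Fin (m + 1) → ℝ[X]} {δ₀ δ₁ : ℝ[X]}
    (hrep : ∀ P : ℝ[X], P.degree < q → ∀ θ : ℝ,
      ∑ i : Fin (m + 1), (ω i).eval θ * P.eval ((i : ℝ) / m)
        + δ₀.eval θ * P.derivative.eval 0 + δ₁.eval θ * P.derivative.eval 1 = P.eval θ)
    {a H : ℝ} (hH : 0 < H) (c : ℕ → E) (v : Fin (m + 1) → E) (d₀ d₁ : E) (s : ℝ) :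
    ∑ i : Fin (m + 1), (ω i).eval ((s - a) / H) • v i
          + H • (δ₀.eval ((s - a) / H) • d₀ + δ₁.eval ((s - a) / H) • d₁)
      = ∑ k : Fin (n + 1), (X ^ (k : ℕ) : ℝ[X]).eval ((s - a) / 1) • c k
        + ∑ j : Fin (m + 1) ⊕ Bool,
          (Sum.elim ω (fun b => cond b δ₁ δ₀) j).eval ((s - a) / H) •
            (Sum.elim
              (fun i => v i - ∑ k ∈ Finset.range (n + 1), (a + (i : ℝ) * (H / m) - a) ^ k • c k)
              (fun b => cond b
                (H • (d₁ - ∑ k ∈ Finset.range n, (a + H - a) ^ k • ((k : ℝ) + 1) • c (k + 1)))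
                (H • (d₀ - ∑ k ∈ Finset.range n, (a - a) ^ k • ((k : ℝ) + 1) • c (k + 1)))) j) := by
  have h := spline_reproduces (a := a) hnq hrep hH c s
  have e1 : ∑ k : Fin (n + 1), (X ^ (k : ℕ) : ℝ[X]).eval ((s - a) / 1) • c k
      = ∑ k ∈ Finset.range (n + 1), (s - a) ^ k • c k := by
    rw [Finset.sum_range]; simp
  rw [e1, ← h, Fintype.sum_sum_type, Fintype.sum_bool]
  simp only [Sum.elim_inl, Sum.elim_inr, cond_true, cond_false, smul_sub, Finset.sum_sub_distrib,
    smul_add, smul_comm H]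
  abel

/-- Error bounds and derivative bounds for the waveforms of a spline rule. -/
theorem SplineRule.HasOrder.exists_waveform_bounds {m p q : ℕ} (hq : 1 ≤ q)
    {R : SplineRule m E} (hR : R.HasOrder q) {κ : ℝ} (hκ : 0 ≤ κ) (B : ℝ) :
    ∃ c W : ℝ, 0 ≤ c ∧ ∀ (D : ℕ → ℝ → E) (t₀ T : ℝ),
      (∀ k ≤ p, ∀ t ∈ Icc t₀ T, HasDerivWithinAt (D k) (D (k + 1) t) (Icc t₀ T) t) →
      (∀ k ≤ p + 1, ∀ t ∈ Icc t₀ T, ‖D k t‖ ≤ B) →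
      ∀ (a H η : ℝ) (v : Fin (m + 1) → E) (d₀ d₁ : E) (w : ℝ → E), 0 < H → H ≤ 1 →
        a ∈ Icc t₀ T → a + H ∈ Icc t₀ T → R a H v d₀ d₁ w →
        (∀ i, ‖v i - D 0 (a + (i : ℝ) * (H / m))‖ ≤ η) →
        ‖d₀ - D 1 a‖ ≤ η → ‖d₁ - D 1 (a + H)‖ ≤ η →
        ContDiff ℝ p w ∧
        (∀ s ∈ Icc t₀ T, |s - a| ≤ 2 * H → ‖w s - D 0 s‖ ≤ c * (η + H ^ min p q)) ∧
        ((∀ i, ‖(v i - D 0 (a + (i : ℝ) * (H / m))) - (v 0 - D 0 a)‖ ≤ H ^ min p q) →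
          H * η ≤ H ^ min p q → η ≤ 1 →
          ∀ k ≤ p, ∀ s, |s - a| ≤ κ * H → ‖iteratedDeriv k w s‖ ≤ W) := by
  obtain ⟨ω, δ₀, δ₁, hω, hδ₀, hδ₁, hrep, hform⟩ := hR
  -- The largest useful Taylor degree: n < q lets the rule reproduce the polynomial, n ≤ p makes `D
  -- (n + 1)` available for the remainder, and n + 1 ≥ min p q suffices for the order.
  set n := min p (q - 1) with hn
  have hnq : n < q := by lia
  have hnp : n ≤ p := min_le_left _ _
  set ψ : Fin (m + 1) ⊕ Bool → ℝ[X] := Sum.elim ω (fun b => cond b δ₁ δ₀) with hψ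
  obtain ⟨A, hA0, hA⟩ := Polynomial.exists_abs_eval_iterate_derivative_le ψ n (max κ 2)
  -- The Taylor part is treated as a waveform with window length 1, so the same estimates serve it
  -- without negative powers of H.
  obtain ⟨A', hA'0, hA'⟩ := Polynomial.exists_abs_eval_iterate_derivative_le
    (fun k : Fin (n + 1) => (X ^ (k : ℕ) : ℝ[X])) n κ
  -- The error constant collects the constant shift, the spline of the residuals (at most 3 η + B
  -- H^(n+1)), and the Taylor remainder at distance at most 2H. In W, the coefficient |B| + 1 bounds
  -- the Taylor coefficients and 2 + |B| the residuals divided by H^r; η enters only through η ≤ 1.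
  refine ⟨1 + 3 * A + |B| * 2 ^ (n + 1) + A * |B|, A' * (|B| + 1) + A * (2 + |B|),
    by positivity, ?_⟩
  intro D t₀ T hD hB a H η v d₀ d₁ w hH hH1 ha haH hRw hv hd₀ hd₁
  have hη : 0 ≤ η := (norm_nonneg _).trans hd₀
  have hB0 : 0 ≤ B := (norm_nonneg _).trans (hB 0 (by lia) a ha)
  rw [abs_of_nonneg hB0]
  have hw := (hform a H v d₀ d₁ w hH).1 hRw
  -- The decisive choice: the constant coefficient is the computed value `v 0`, not `D 0 a`. The
  -- accumulated error thus moves into a constant, and the residual node data contain only its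
  -- variation, which is small enough to be divided by H^k.
  set c : ℕ → E := fun k => if k = 0 then v 0 else (k.factorial : ℝ)⁻¹ • D k a with hc
  set ζ : Fin (m + 1) ⊕ Bool → E := Sum.elim
      (fun i => v i - ∑ k ∈ Finset.range (n + 1), (a + (i : ℝ) * (H / m) - a) ^ k • c k)
      (fun b => cond b
        (H • (d₁ - ∑ k ∈ Finset.range n, (a + H - a) ^ k • ((k : ℝ) + 1) • c (k + 1)))
        (H • (d₀ - ∑ k ∈ Finset.range n, (a - a) ^ k • ((k : ℝ) + 1) • c (k + 1)))) with hζ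
  have hwrep : w = fun s => ∑ k : Fin (n + 1), (X ^ (k : ℕ) : ℝ[X]).eval ((s - a) / 1) • c k
        + ∑ j, (ψ j).eval ((s - a) / H) • ζ j := by
    funext s
    rw [hw s, spline_eq_taylor_add hnq hrep hH c]
  have hPdiff : ∀ N : WithTop ℕ∞, ContDiff ℝ N (fun s : ℝ => ∑ k : Fin (n + 1),
      (X ^ (k : ℕ) : ℝ[X]).eval ((s - a) / 1) • c k) :=
    fun N => ContDiff.sum fun k _ => contDiff_eval_div_smul _ a 1 (c k)
  have hQdiff : ∀ N : WithTop ℕ∞, ContDiff ℝ N (fun s : ℝ => ∑ j, (ψ j).eval ((s - a) / H) • ζ j) :=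
    fun N => ContDiff.sum fun j _ => contDiff_eval_div_smul _ a H (ζ j)
  have htaylor : ∀ s, ∑ k ∈ Finset.range (n + 1), (s - a) ^ k • c k
      = ∑ k ∈ Finset.range (n + 1), (s - a) ^ k • ((k.factorial : ℝ)⁻¹ • D k a)
        + (v 0 - D 0 a) := by
    intro s
    simp [Finset.sum_range_succ', hc]
  have htaylor' : ∀ s, ∑ k ∈ Finset.range n, (s - a) ^ k • ((k : ℝ) + 1) • c (k + 1)
      = ∑ k ∈ Finset.range n, (s - a) ^ k • ((k.factorial : ℝ)⁻¹ • D (k + 1) a) := by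
    intro s
    refine Finset.sum_congr rfl fun k _ => ?_
    simp only [hc, Nat.succ_ne_zero, if_false, smul_smul]
    congr 1
    rw [Nat.factorial_succ]
    push_cast
    have : (k.factorial : ℝ) ≠ 0 := by positivity
    have : (k : ℝ) + 1 ≠ 0 := by positivity
    field_simp
  have hT : ∀ s ∈ Icc t₀ T, ‖D 0 s - ∑ k ∈ Finset.range (n + 1),
      (s - a) ^ k • ((k.factorial : ℝ)⁻¹ • D k a)‖ ≤ B * |s - a| ^ (n + 1) := fun s hs =>
    norm_sub_taylor_sum_le ha hs (n + 1) D (fun k hk => hD k (by lia)) (hB (n + 1) (by lia))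
  have hT' : ∀ s ∈ Icc t₀ T, ‖D 1 s - ∑ k ∈ Finset.range n,
      (s - a) ^ k • ((k.factorial : ℝ)⁻¹ • D (k + 1) a)‖ ≤ B * |s - a| ^ n := fun s hs =>
    norm_sub_taylor_sum_le ha hs n (fun k => D (k + 1)) (fun k hk => hD (k + 1) (by lia))
      (hB (n + 1) (by lia))
  -- Used twice: σ = 2 η for the error of the waveform, which needs no variation hypothesis, and σ =
  -- H ^ min p q for its derivatives.
  have hζle : ∀ σ, 0 ≤ σ → (∀ i, ‖(v i - D 0 (a + (i : ℝ) * (H / m))) - (v 0 - D 0 a)‖ ≤ σ) →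
      ∀ j, ‖ζ j‖ ≤ σ + H * η + B * H ^ (n + 1) := by
    intro σ hσ0 hσ j
    have hslope : ∀ d s, s ∈ Icc t₀ T → ‖d - D 1 s‖ ≤ η → |s - a| ≤ H →
        ‖H • (d - ∑ k ∈ Finset.range n, (s - a) ^ k • ((k : ℝ) + 1) • c (k + 1))‖
          ≤ σ + H * η + B * H ^ (n + 1) := by
      intro d s hs hd hsa
      rw [norm_smul, Real.norm_eq_abs, abs_of_pos hH, htaylor']
      have h1 := norm_sub_le_norm_sub_add_norm_sub d (D 1 s) (∑ k ∈ Finset.range n,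
        (s - a) ^ k • ((k.factorial : ℝ)⁻¹ • D (k + 1) a))
      have h2 : B * |s - a| ^ n ≤ B * H ^ n := by
        exact mul_le_mul_of_nonneg_left (pow_le_pow_left₀ (abs_nonneg _) hsa n) hB0
      have h3 := hT' s hs
      rw [pow_succ]
      nlinarith
    rcases j with i | b
    · simp only [hζ, Sum.elim_inl]
      rw [htaylor]
      have hnode : a + (i : ℝ) * (H / m) ∈ Icc t₀ T ∧ |a + (i : ℝ) * (H / m) - a| ≤ H := by
        have hi : (i : ℝ) * (H / m) ≤ H := by
          rcases Nat.eq_zero_or_pos m with rfl | hm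
          · simpa using hH.le
          · have : (i : ℝ) ≤ m := by exact_mod_cast Nat.lt_succ_iff.1 i.2
            have hm' : (0 : ℝ) < m := by exact_mod_cast hm
            calc (i : ℝ) * (H / m) ≤ m * (H / m) := by gcongr
              _ = H := by field_simp
        have hi0 : 0 ≤ (i : ℝ) * (H / m) := by positivity
        rw [add_sub_cancel_left, abs_of_nonneg hi0]
        exact ⟨⟨by linarith [ha.1], by linarith [haH.2]⟩, hi⟩
      have h1 := hT _ hnode.1
      have h2 : B * |a + (i : ℝ) * (H / m) - a| ^ (n + 1) ≤ B * H ^ (n + 1) :=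
        mul_le_mul_of_nonneg_left (pow_le_pow_left₀ (abs_nonneg _) hnode.2 _) hB0
      set t := a + (i : ℝ) * (H / m)
      set S := ∑ k ∈ Finset.range (n + 1), (t - a) ^ k • ((k.factorial : ℝ)⁻¹ • D k a)
      have h3 : v i - (S + (v 0 - D 0 a)) = ((v i - D 0 t) - (v 0 - D 0 a)) + (D 0 t - S) := by abel
      rw [h3]
      refine (norm_add_le _ _).trans ?_
      linarith [hσ i, mul_nonneg hH.le hη]
    · cases b
      · exact hslope d₀ a ha hd₀ (by simpa using hH.le)
      · exact hslope d₁ (a + H) haH hd₁ (by simp [abs_of_pos hH])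
  have hHpow : H ^ (n + 1) ≤ H ^ min p q := pow_le_pow_of_le_one hH.le hH1 (by lia)
  have hHr0 : 0 ≤ H ^ min p q := by positivity
  have hv0 : ‖v 0 - D 0 a‖ ≤ η := by simpa using hv 0
  refine ⟨?_, ?_, ?_⟩
  · rw [hwrep]; exact (hPdiff p).add (hQdiff p)
  · intro s hs hsa
    have hζ2 := hζle (2 * η) (by positivity) fun i => by
      linarith [norm_sub_le (v i - D 0 (a + (i : ℝ) * (H / m))) (v 0 - D 0 a), hv i]
    have hQ := norm_iteratedDeriv_sum_eval_div_smul_le hA hH (by positivity) hζ2 (Nat.zero_le n)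
      (s := s) (a := a) (hsa.trans (by gcongr; exact le_max_right _ _))
    rw [iteratedDeriv_zero, pow_zero, one_mul] at hQ
    have hTs := hT s hs
    have hP : ∑ k : Fin (n + 1), (X ^ (k : ℕ) : ℝ[X]).eval ((s - a) / 1) • c k
        = ∑ k ∈ Finset.range (n + 1), (s - a) ^ k • ((k.factorial : ℝ)⁻¹ • D k a)
          + (v 0 - D 0 a) := by
      rw [← htaylor, Finset.sum_range]; simp
    have hpow : B * |s - a| ^ (n + 1) ≤ B * 2 ^ (n + 1) * H ^ (n + 1) := by
      rw [mul_assoc, ← mul_pow]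
      exact mul_le_mul_of_nonneg_left (pow_le_pow_left₀ (abs_nonneg _) hsa _) hB0
    rw [congrFun hwrep s, hP]
    set S := ∑ k ∈ Finset.range (n + 1), (s - a) ^ k • ((k.factorial : ℝ)⁻¹ • D k a)
    set Q := ∑ j, (ψ j).eval ((s - a) / H) • ζ j
    have e1 : S + (v 0 - D 0 a) + Q - D 0 s = (v 0 - D 0 a) + Q - (D 0 s - S) := by abel
    rw [e1]
    have e2 := norm_sub_le ((v 0 - D 0 a) + Q) (D 0 s - S)
    have e3 := norm_add_le (v 0 - D 0 a) Q
    have e4 : H * η ≤ η := by nlinarith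
    have e5 : A * (2 * η + H * η + B * H ^ (n + 1)) ≤ A * (3 * η + B * H ^ min p q) := by
      gcongr; linarith
    have e6 : B * 2 ^ (n + 1) * H ^ (n + 1) ≤ B * 2 ^ (n + 1) * H ^ min p q := by gcongr
    have e7 : 0 ≤ (B * 2 ^ (n + 1) + A * B) * η := by positivity
    have e8 : 0 ≤ (1 + 3 * A) * H ^ min p q := by positivity
    linarith
  · intro hσ hHη hη1 k hk s hsa
    -- If n < k ≤ p then n = q - 1, so k ≥ q and the derivative of the polynomial piece vanishes
    -- identically.
    rcases Nat.lt_or_ge n k with hkn | hkn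
    · have hqk : q ≤ k := by lia
      have hz : ∀ P : ℝ[X], P.degree < q → derivative^[k] P = 0 := fun P hP =>
        iterate_derivative_eq_zero_of_degree_lt (hP.trans_le (by exact_mod_cast hqk))
      have hw' : w = fun s => ∑ j, (ψ j).eval ((s - a) / H) •
          Sum.elim v (fun b => cond b (H • d₁) (H • d₀)) j := by
        funext s
        rw [hw s, Fintype.sum_sum_type, Fintype.sum_bool]
        simp only [hψ, Sum.elim_inl, Sum.elim_inr, cond_true, cond_false, smul_add, smul_comm H]
        abel
      have hψz : ∀ j, derivative^[k] (ψ j) = 0 := by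
        rintro (i | b)
        · exact hz _ (hω i)
        · cases b
          · exact hz _ hδ₀
          · exact hz _ hδ₁
      rw [hw', iteratedDeriv_sum_eval_div_smul, Finset.sum_eq_zero fun j _ => by simp [hψz j],
        norm_zero]
      positivity
    · rw [hwrep]
      have hadd := iteratedDeriv_fun_add (x := s) ((hPdiff k).contDiffAt) ((hQdiff k).contDiffAt)
      rw [hadd]
      refine (norm_add_le _ _).trans (add_le_add ?_ ?_)
      · have := norm_iteratedDeriv_sum_eval_div_smul_le hA' one_pos (a := a) (s := s)
          (ζ := fun k : Fin (n + 1) => c k) (τ := B + 1) (by positivity) ?_ hkn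
          (hsa.trans (by gcongr))
        · simpa using this
        · intro j
          simp only [hc]
          split_ifs with hj
          · linarith [norm_le_norm_sub_add (v 0) (D 0 a), hB 0 (by lia) a ha]
          · rw [norm_smul, norm_inv, Real.norm_natCast]
            have h1 := hB j (by have := j.2; lia) a ha
            have h2 : ((j : ℕ).factorial : ℝ)⁻¹ ≤ 1 :=
              inv_le_one_of_one_le₀ (by exact_mod_cast Nat.one_le_iff_ne_zero.2 (Nat.factorial_ne_zero _))
            nlinarith [norm_nonneg (D j a)]
      · have := norm_iteratedDeriv_sum_eval_div_smul_le hA hH (by positivity) (hζle _ hHr0 hσ) hkn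
          (s := s) (a := a) (hsa.trans (by gcongr; exact le_max_left _ _))
        refine this.trans ?_
        gcongr
        rw [inv_pow, inv_mul_le_iff₀ (by positivity)]
        have h1 : H ^ min p q ≤ H ^ k := pow_le_pow_of_le_one hH.le hH1 (by lia)
        nlinarith

end Waveform

/-! ### Integration of one component along a waveform of the other -/

section WaveformStep

open Set Metric

/-- Solutions of a differential equation with a `C ^ p` right-hand side have bounded derivatives
up to order `p + 1`. -/
theorem SolvesODE.exists_derivative_chain {E : Type*} [NormedAddCommGroup E] [NormedSpace ℝ E]
    [CompleteSpace E] {g : ℝ → E → E} {t₀ T : ℝ} {u : ℝ → E} {p : ℕ} (hT : t₀ < T)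
    (hg : ContDiff ℝ p (fun z : ℝ × E => g z.1 z.2)) (hu : SolvesODE g t₀ T u) :
    ∃ (D : ℕ → ℝ → E) (B : ℝ), D 0 = u ∧ (∀ t, D 1 t = g t (u t)) ∧
      (∀ k ≤ p, ∀ t ∈ Icc t₀ T, HasDerivWithinAt (D k) (D (k + 1) t) (Icc t₀ T) t) ∧
      ∀ k ≤ p + 1, ∀ t ∈ Icc t₀ T, ‖D k t‖ ≤ B := by
  have hus : ContDiffOn ℝ p u (Icc t₀ T) :=
    ODE.contDiffOn_enat_Icc_of_hasDerivWithinAt (n := (p : ℕ∞)) (u := univ)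
      (by exact_mod_cast hg.contDiffOn) hu (mapsTo_univ _ _)
  have hw : ContDiffOn ℝ p (fun t => g t (u t)) (Icc t₀ T) :=
    hg.comp_contDiffOn (contDiffOn_id.prodMk hus)
  have hS : UniqueDiffOn ℝ (Icc t₀ T) := uniqueDiffOn_Icc hT
  -- From index 1 on these are derivatives of t ↦ g(t, u(t)), which is C^p like u; this yields the
  -- additional derivative of order p + 1.
  let D : ℕ → ℝ → E := fun k =>
    Nat.casesOn k u fun j => iteratedDerivWithin j (fun t => g t (u t)) (Icc t₀ T)
  have hD : ∀ k ≤ p, ∀ t ∈ Icc t₀ T, HasDerivWithinAt (D k) (D (k + 1) t) (Icc t₀ T) t := by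
    intro k hk t ht
    rcases k with _ | k
    · have h1 : D (0 + 1) t = g t (u t) := by simp [D]
      rw [h1]
      exact hu t ht
    · have h1 := (hw.differentiableOn_iteratedDerivWithin (m := k)
        (by exact_mod_cast hk) hS t ht).hasDerivWithinAt
      have h2 : D (k + 1 + 1) t
          = derivWithin (iteratedDerivWithin k (fun t => g t (u t)) (Icc t₀ T)) (Icc t₀ T) t :=
        congrFun iteratedDerivWithin_succ t
      rw [h2]
      exact h1
  have hcont : ∀ k ≤ p + 1, ContinuousOn (D k) (Icc t₀ T) := by
    intro k hk
    rcases k with _ | k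
    · exact hus.continuousOn
    · exact hw.continuousOn_iteratedDerivWithin (m := k) (by exact_mod_cast (by lia : k ≤ p)) hS
  have hbd : ∀ k : ℕ, ∃ B : ℝ, k ≤ p + 1 → ∀ t ∈ Icc t₀ T, ‖D k t‖ ≤ B := by
    intro k
    by_cases hk : k ≤ p + 1
    · obtain ⟨B, hB⟩ := isCompact_Icc.exists_bound_of_continuousOn (hcont k hk)
      exact ⟨B, fun _ => hB⟩
    · exact ⟨0, fun h => absurd h hk⟩
  choose B hB using hbd
  refine ⟨D, ∑ k ∈ Finset.range (p + 2), |B k|, rfl, fun t => by simp [D], hD, fun k hk t ht => ?_⟩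
  refine (hB k hk t ht).trans ((le_abs_self _).trans ?_)
  exact Finset.single_le_sum (f := fun k => |B k|) (fun _ _ => abs_nonneg _)
    (Finset.mem_range.2 (by lia))

variable {E E' : Type*} [NormedAddCommGroup E] [NormedSpace ℝ E] [ProperSpace E]
  [NormedAddCommGroup E'] [NormedSpace ℝ E'] [ProperSpace E']

set_option maxHeartbeats 1000000 in
/-- Integration of one component over a window `[b, b + H]` by `k` steps, where the other component
is replaced by the waveform of a spline rule on `[a, a + H]`. -/
theorem exists_waveform_integration_bound {m k p q : ℕ} (hk : 1 ≤ k) (hp : 1 ≤ p) (hq : 1 ≤ q)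
    {Φ : OneStep E} (hΦ : Φ.HasOrder p) {R : SplineRule m E'} (hR : R.HasOrder q)
    {f : ℝ → E → E' → E} (hf : ContDiff ℝ p (fun z : ℝ × E × E' => f z.1 z.2.1 z.2.2))
    {t₀ T B : ℝ} {x : ℝ → E} {D : ℕ → ℝ → E'}
    (hx : ∀ t ∈ Icc t₀ T, HasDerivWithinAt x (f t (x t) (D 0 t)) (Icc t₀ T) t)
    (hxB : ∀ t ∈ Icc t₀ T, ‖x t‖ ≤ B) (hxB' : ∀ t ∈ Icc t₀ T, ‖f t (x t) (D 0 t)‖ ≤ B)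
    (hD : ∀ k ≤ p, ∀ t ∈ Icc t₀ T, HasDerivWithinAt (D k) (D (k + 1) t) (Icc t₀ T) t)
    (hB : ∀ k ≤ p + 1, ∀ t ∈ Icc t₀ T, ‖D k t‖ ≤ B) :
    ∃ c H₀ : ℝ, 0 ≤ c ∧ 0 < H₀ ∧
      ∀ (a b H η : ℝ) (v : Fin (m + 1) → E') (d₀ d₁ : E') (w : ℝ → E') (y : E), 0 < H → H ≤ H₀ →
        t₀ ≤ a → a ≤ b → b ≤ a + H → b + H ≤ T → R a H v d₀ d₁ w →
        (∀ i, ‖v i - D 0 (a + (i : ℝ) * (H / m))‖ ≤ η) →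
        ‖d₀ - D 1 a‖ ≤ η → ‖d₁ - D 1 (a + H)‖ ≤ η →
        (∀ i, ‖(v i - D 0 (a + (i : ℝ) * (H / m))) - (v 0 - D 0 a)‖ ≤ H ^ min p q) →
        H * η ≤ H ^ min p q → η ≤ 1 → ‖y - x b‖ ≤ 1 / 8 → c * (η + H ^ min p q) ≤ 1 →
        (∀ s ∈ Icc b (b + H), ‖w s - D 0 s‖ ≤ c * (η + H ^ min p q)) ∧
        ∀ i ≤ k, ‖(Φ.steps (fun t x => f t x (w t)) b (H / k) y i - x (b + i * (H / k))) - (y - x b)‖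
          ≤ c * H * (‖y - x b‖ + η + H ^ min p q) := by
  obtain ⟨κ, hκ, hΦ'⟩ := hΦ.exists_steps_bound hp k
  -- The scheme looks κ H around b, and b is at most H away from the start a of the spline window.
  obtain ⟨cw, W, hcw, hwave⟩ := hR.exists_waveform_bounds (p := p) hq (κ := κ + 1) (by linarith) B
  -- A radius for all arguments of f that occur: times within (κ + 1) H of a, states within 2 of the
  -- solution, and waveform values. It depends neither on H nor on η, so M, Λ and C do not either.
  set ρ := |t₀| + |T| + κ + 1 + (|B| + 2) + |W| with hρ
  set L : ℝ × E →L[ℝ] ℝ × E × E' := (ContinuousLinearMap.fst ℝ ℝ E).prod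
    ((ContinuousLinearMap.snd ℝ ℝ E).prod 0) with hL
  set J : E' →L[ℝ] ℝ × E × E' := (0 : E' →L[ℝ] ℝ).prod
    ((0 : E' →L[ℝ] E).prod (ContinuousLinearMap.id ℝ E')) with hJ
  have hLJ : ∀ (z : ℝ × E) (y : E'), L z + J y = (z.1, z.2, y) := by
    intro z y; simp [hL, hJ]
  obtain ⟨M, hM⟩ := hf.exists_norm_iteratedFDeriv_comp_waveform_le L J ρ W
  obtain ⟨Λ, hΛ0, hΛ⟩ := hf.exists_norm_sub_le_mul hp ρ
  obtain ⟨C, h₀, hC0, hh₀, hC⟩ := hΦ' M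
  have hBabs : 0 ≤ |B| := abs_nonneg B
  -- The term 8 Λ cw turns c (η + H^r) ≤ 1 into the defect bound δ ≤ 1/8. The second bound on H
  -- keeps the exact curve within 1/8 of its value at b.
  refine ⟨cw + 8 * Λ * cw + C * (1 + Λ * cw), min (min h₀ 1) (1 / (8 * (|B| + 1))), by positivity,
    by positivity, ?_⟩
  intro a b H η v d₀ d₁ w y hH hHle hta hab hba hbT hRw hv hd₀ hd₁ hσ hHη hη1 hy hcη
  have hHh₀ : H ≤ h₀ := hHle.trans ((min_le_left _ _).trans (min_le_left _ _))
  have hH1 : H ≤ 1 := hHle.trans ((min_le_left _ _).trans (min_le_right _ _))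
  have hHB : H ≤ 1 / (8 * (|B| + 1)) := hHle.trans (min_le_right _ _)
  rw [le_div_iff₀ (by positivity)] at hHB
  have hη : 0 ≤ η := (norm_nonneg _).trans hd₀
  have hr0 : 0 ≤ H ^ min p q := by positivity
  have hk' : (1 : ℝ) ≤ k := by exact_mod_cast hk
  have hkh : (k : ℝ) * (H / k) = H := by field_simp
  have hh : 0 < H / k := by positivity
  have hhH : H / k ≤ H := div_le_self hH.le hk'
  have hsub : Icc b (b + H) ⊆ Icc t₀ T := Icc_subset_Icc (by linarith) hbT
  obtain ⟨hwdiff, hwerr, hwder⟩ := hwave D t₀ T hD hB a H η v d₀ d₁ w hH hH1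
    ⟨hta, by linarith⟩ ⟨by linarith, by linarith⟩ hRw hv hd₀ hd₁
  have hwder := hwder hσ hHη hη1
  have hsa : ∀ s ∈ Icc b (b + H), |s - a| ≤ 2 * H := fun s hs => by
    rw [abs_of_nonneg (by linarith [hs.1])]; linarith [hs.2]
  have hwerr' : ∀ s ∈ Icc b (b + H), ‖w s - D 0 s‖ ≤ cw * (η + H ^ min p q) :=
    fun s hs => hwerr s (hsub hs) (hsa s hs)
  have hwW : ∀ s, |s - a| ≤ (κ + 1) * H → ‖w s‖ ≤ W := fun s hs => by
    simpa using hwder 0 (Nat.zero_le _) s hs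
  have hηr : 0 ≤ η + H ^ min p q := by positivity
  have hbmem : b ∈ Icc b (b + H) := ⟨le_rfl, by linarith⟩
  have htime : ∀ s ∈ Icc t₀ T, |s| ≤ |t₀| + |T| := fun s hs =>
    (abs_le_max_abs_abs hs.1 hs.2).trans (max_le_add_of_nonneg (abs_nonneg _) (abs_nonneg _))
  have hnorm3 : ∀ (s : ℝ) (x : E) (y : E') (ρ : ℝ), |s| ≤ ρ → ‖x‖ ≤ ρ → ‖y‖ ≤ ρ →
      ‖(s, x, y)‖ ≤ ρ := fun s x y ρ h1 h2 h3 =>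
    norm_prod_le_iff.2 ⟨h1, norm_prod_le_iff.2 ⟨h2, h3⟩⟩
  have hWabs := le_abs_self W
  have hBle := le_abs_self B
  have hW0 : 0 ≤ |W| := abs_nonneg W
  have ht0abs := abs_nonneg t₀
  have hTabs := abs_nonneg T
  set δ := Λ * (cw * (η + H ^ min p q)) with hδ
  have hmain := hC (fun t x => f t x (w t)) b (H / k) δ y x (fun t => f t (x t) (D 0 t)) hh
    (hhH.trans hHh₀) ?_ ?_ ?_ ?_ ?_ hy ?_
  · refine ⟨fun s hs => (hwerr' s hs).trans ?_, fun i hi => (hmain i hi).trans ?_⟩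
    · refine mul_le_mul_of_nonneg_right ?_ hηr
      have : 0 ≤ 8 * Λ * cw + C * (1 + Λ * cw) := by positivity
      linarith
    · have hihH : (i : ℝ) * (H / k) ≤ H := by
        calc (i : ℝ) * (H / k) ≤ k * (H / k) := by gcongr
          _ = H := hkh
      have hhp : (H / k) ^ p ≤ H ^ min p q :=
        (pow_le_pow_left₀ hh.le hhH p).trans (pow_le_pow_of_le_one hH.le hH1 (min_le_left _ _))
      calc C * (i * (H / k)) * (‖y - x b‖ + δ + (H / k) ^ p)
          ≤ C * H * (‖y - x b‖ + δ + H ^ min p q) := by gcongr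
        _ ≤ C * H * ((1 + Λ * cw) * (‖y - x b‖ + η + H ^ min p q)) := by
            refine mul_le_mul_of_nonneg_left ?_ (by positivity)
            have : 0 ≤ Λ * cw * ‖y - x b‖ := by positivity
            rw [hδ]; linarith
        _ ≤ (cw + 8 * Λ * cw + C * (1 + Λ * cw)) * H * (‖y - x b‖ + η + H ^ min p q) := by
            have : 0 ≤ (cw + 8 * Λ * cw) * H * (‖y - x b‖ + η + H ^ min p q) := by positivity
            linarith
  · exact hf.comp (contDiff_fst.prodMk (contDiff_snd.prodMk (hwdiff.comp contDiff_fst)))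
  · intro j hj s ξ hs hξ
    have h1 : |s - a| ≤ (κ + 1) * H := by
      have h2 := abs_add_le (s - b) (b - a)
      rw [show s - b + (b - a) = s - a by ring, abs_of_nonneg (by linarith : 0 ≤ b - a)] at h2
      have h3 : κ * (H / k) ≤ κ * H := by gcongr
      linarith
    have h4 := hM w s ξ hwdiff ?_ (fun i hi => hwder i hi s h1) j hj
    · simpa only [hLJ] using h4
    · rw [hLJ]
      refine hnorm3 _ _ _ _ ?_ ?_ ?_
      · have h5 := abs_add_le (s - a) a
        rw [sub_add_cancel] at h5
        have h6 := htime a ⟨hta, by linarith⟩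
        have h7 : (κ + 1) * H ≤ κ + 1 := by nlinarith
        linarith
      · have h5 := norm_le_norm_sub_add ξ (x b)
        have h6 := hxB b (hsub hbmem)
        linarith
      · linarith [hwW s h1]
  · rw [hkh]; exact fun s hs => (hx s (hsub hs)).mono hsub
  · rw [hkh]
    intro s hs
    have h1 := hΛ (s, x s, D 0 s) (s, x s, w s) ?_ ?_
    · refine h1.trans ?_
      rw [hδ]
      refine mul_le_mul_of_nonneg_left ?_ hΛ0
      rw [Prod.mk_sub_mk, Prod.mk_sub_mk, sub_self, sub_self]
      refine hnorm3 _ _ _ _ ?_ ?_ ?_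
      · rw [abs_zero]; positivity
      · rw [norm_zero]; positivity
      · rw [norm_sub_rev]; exact hwerr' s hs
    · refine hnorm3 _ _ _ _ ?_ ?_ ?_
      · linarith [htime s (hsub hs)]
      · linarith [hxB s (hsub hs)]
      · linarith [hB 0 (by lia) s (hsub hs)]
    · refine hnorm3 _ _ _ _ ?_ ?_ ?_
      · linarith [htime s (hsub hs)]
      · linarith [hxB s (hsub hs)]
      · linarith [hwW s ((hsa s hs).trans (by gcongr; linarith))]
  · rw [hkh]
    intro s hs
    have h1 := (convex_Icc t₀ T).norm_image_sub_le_of_norm_hasDerivWithin_le hx hxB' (hsub hbmem)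
      (hsub hs)
    refine h1.trans ?_
    rw [Real.norm_eq_abs, abs_of_nonneg (by linarith [hs.1])]
    nlinarith [hs.1, hs.2]
  · have h1 : 8 * Λ * cw * (η + H ^ min p q)
        ≤ (cw + 8 * Λ * cw + C * (1 + Λ * cw)) * (η + H ^ min p q) := by
      refine mul_le_mul_of_nonneg_right ?_ hηr
      have : 0 ≤ C * (1 + Λ * cw) := by positivity
      linarith
    rw [hδ]; linarith

end WaveformStep

/-! ### Starting window and error propagation over one window -/

section Window

open Set Metric

/-- Starting phase: `m` steps with exact initial value. -/
theorem exists_start_bound {E : Type*} [NormedAddCommGroup E] [NormedSpace ℝ E] [ProperSpace E]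
    {m p : ℕ} (hm : 1 ≤ m) (hp : 1 ≤ p) {Φ : OneStep E} (hΦ : Φ.HasOrder p) {g : ℝ → E → E}
    (hg : ContDiff ℝ p (fun z : ℝ × E => g z.1 z.2)) {t₀ T B : ℝ} {u : ℝ → E}
    (hu : SolvesODE g t₀ T u) (huB : ∀ t ∈ Icc t₀ T, ‖g t (u t)‖ ≤ B) :
    ∃ c H₀ : ℝ, 0 ≤ c ∧ 0 < H₀ ∧ ∀ H, 0 < H → H ≤ H₀ → t₀ + H ≤ T →
      ∀ i ≤ m, ‖Φ.steps g t₀ (H / m) (u t₀) i - u (t₀ + i * (H / m))‖ ≤ c * (H * H ^ p) := by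
  obtain ⟨κ, hκ, hΦ'⟩ := hΦ.exists_steps_bound hp m
  obtain ⟨M, hM0, hM⟩ := hg.exists_norm_iteratedFDeriv_le (|t₀| + κ + ‖u t₀‖ + 2)
  obtain ⟨C, h₀, hC0, hh₀, hC⟩ := hΦ' M
  refine ⟨C, min (min h₀ 1) (1 / (8 * (|B| + 1))), hC0, by positivity, ?_⟩
  intro H hH hHle hHT i hi
  have hHh₀ : H ≤ h₀ := hHle.trans ((min_le_left _ _).trans (min_le_left _ _))
  have hH1 : H ≤ 1 := hHle.trans ((min_le_left _ _).trans (min_le_right _ _))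
  have hHB : H ≤ 1 / (8 * (|B| + 1)) := hHle.trans (min_le_right _ _)
  rw [le_div_iff₀ (by positivity)] at hHB
  have hm' : (1 : ℝ) ≤ m := by exact_mod_cast hm
  have hmh : (m : ℝ) * (H / m) = H := by field_simp
  have hh : 0 < H / m := by positivity
  have hhH : H / m ≤ H := div_le_self hH.le hm'
  have hsub : Icc t₀ (t₀ + H) ⊆ Icc t₀ T := Icc_subset_Icc le_rfl hHT
  have htmem : t₀ ∈ Icc t₀ (t₀ + H) := ⟨le_rfl, by linarith⟩
  have hmain := hC g t₀ (H / m) 0 (u t₀) u (fun t => g t (u t)) hh (hhH.trans hHh₀) hg ?_ ?_ ?_ ?_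
    (by simp) (by norm_num) i hi
  · simp only [sub_self, norm_zero, sub_zero, zero_add] at hmain
    refine hmain.trans ?_
    have him : (i : ℝ) ≤ m := by exact_mod_cast hi
    have hihH : (i : ℝ) * (H / m) ≤ H := by
      calc (i : ℝ) * (H / m) ≤ m * (H / m) := by gcongr
        _ = H := hmh
    rw [mul_assoc]
    gcongr
  · intro k hk s x hs hx
    refine hM k hk (s, x) (norm_prod_le_iff.2 ⟨?_, ?_⟩)
    · have h1 := abs_add_le (s - t₀) t₀
      rw [sub_add_cancel] at h1
      have h2 : κ * (H / m) ≤ κ := by nlinarith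
      rw [Real.norm_eq_abs]
      linarith [norm_nonneg (u t₀)]
    · have h1 := norm_le_norm_sub_add x (u t₀)
      have := abs_nonneg t₀
      show ‖x‖ ≤ _
      linarith
  · rw [hmh]; exact fun s hs => (hu s (hsub hs)).mono hsub
  · intro s _; simp
  · rw [hmh]
    intro s hs
    have h1 := (convex_Icc t₀ T).norm_image_sub_le_of_norm_hasDerivWithin_le hu huB (hsub htmem)
      (hsub hs)
    refine h1.trans ?_
    rw [Real.norm_eq_abs, abs_of_nonneg (by linarith [hs.1])]
    have h2 : B * (s - t₀) ≤ |B| * H :=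
      mul_le_mul (le_abs_self B) (by linarith [hs.2]) (by linarith [hs.1]) (abs_nonneg B)
    nlinarith

theorem PartitionedIVP.Smooth.contDiff_full {ES EF : Type*} [NormedAddCommGroup ES]
    [NormedSpace ℝ ES] [NormedAddCommGroup EF] [NormedSpace ℝ EF] {P : PartitionedIVP ES EF} {p : ℕ} (hP : P.Smooth p) :
    ContDiff ℝ p (fun z : ℝ × ES × EF => P.full z.1 z.2) :=
  hP.1.prodMk hP.2

variable {ES EF : Type*} [NormedAddCommGroup ES] [NormedSpace ℝ ES] [ProperSpace ES]
  [NormedAddCommGroup EF] [NormedSpace ℝ EF] [ProperSpace EF]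

set_option maxHeartbeats 1000000 in
/-- Error propagation over one window of the decoupled slowest-first scheme. -/
theorem exists_window_bound {m p q : ℕ} (hm : 1 ≤ m) (hp : 1 ≤ p) (hq : 1 ≤ q)
    {ΦS : OneStep ES} {ΦF : OneStep EF} (hΦS : ΦS.HasOrder p) (hΦF : ΦF.HasOrder p)
    {RF : SplineRule m EF} {RS : SplineRule 1 ES} (hRF : RF.HasOrder q) (hRS : RS.HasOrder q)
    {P : PartitionedIVP ES EF} {uS : ℝ → ES} {uF : ℝ → EF} (hT : P.t₀ < P.T) (hP : P.Smooth p)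
    (hu : P.IsSolution uS uF) :
    ∃ c H₀ : ℝ, 1 ≤ c ∧ 0 < H₀ ∧
      ∀ (a b b' H G : ℝ) (y₀ y₁ y₂ : ES) (z : Fin (m + 1) → EF) (wF : ℝ → EF) (wS : ℝ → ES),
        0 < H → H ≤ H₀ → P.t₀ ≤ a → b = a + H → b' = b + H → b' ≤ P.T →
        H ^ min p q ≤ G → c * G ≤ 1 → c * (H * G) ≤ H ^ min p q →
        ‖y₀ - uS a‖ ≤ G → ‖y₁ - uS b‖ ≤ G → (∀ i, ‖z i - uF (a + (i : ℝ) * (H / m))‖ ≤ G) →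
        (∀ i, ‖(z i - uF (a + (i : ℝ) * (H / m))) - (z 0 - uF a)‖ ≤ H ^ min p q) →
        RF a H z (P.fF a y₀ (z 0)) (P.fF b y₁ (z (Fin.last m))) wF →
        y₂ = ΦS (fun t x => P.fS t x (wF t)) b H y₁ →
        RS b H ![y₁, y₂] (P.fS b y₁ (z (Fin.last m))) (P.fS b' y₂ (wF b')) wS →
        ‖(y₂ - uS b') - (y₁ - uS b)‖ ≤ c * (H * G) ∧
        ∀ i ≤ m, ‖(ΦF.steps (fun t x => P.fF t (wS t) x) b (H / m) (z (Fin.last m)) i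
          - uF (b + i * (H / m))) - (z (Fin.last m) - uF b)‖ ≤ c * (H * G) := by
  obtain ⟨-, -, hsol⟩ := hu
  obtain ⟨D, B, hD0, hD1, hD, hB⟩ := SolvesODE.exists_derivative_chain hT hP.contDiff_full hsol
  set DS : ℕ → ℝ → ES := fun k t => (D k t).1 with hDS
  set DF : ℕ → ℝ → EF := fun k t => (D k t).2 with hDF
  have hDS0 : DS 0 = uS := by simp [hDS, hD0]
  have hDF0 : DF 0 = uF := by simp [hDF, hD0]
  have hDS1 : ∀ t, DS 1 t = P.fS t (uS t) (uF t) := fun t => by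
    simp [hDS, hD1, PartitionedIVP.full]
  have hDF1 : ∀ t, DF 1 t = P.fF t (uS t) (uF t) := fun t => by
    simp [hDF, hD1, PartitionedIVP.full]
  have hDSd : ∀ k ≤ p, ∀ t ∈ Icc P.t₀ P.T,
      HasDerivWithinAt (DS k) (DS (k + 1) t) (Icc P.t₀ P.T) t := fun k hk t ht =>
    (ContinuousLinearMap.fst ℝ ES EF).hasFDerivAt.comp_hasDerivWithinAt t (hD k hk t ht)
  have hDFd : ∀ k ≤ p, ∀ t ∈ Icc P.t₀ P.T,
      HasDerivWithinAt (DF k) (DF (k + 1) t) (Icc P.t₀ P.T) t := fun k hk t ht =>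
    (ContinuousLinearMap.snd ℝ ES EF).hasFDerivAt.comp_hasDerivWithinAt t (hD k hk t ht)
  have hBS : ∀ k ≤ p + 1, ∀ t ∈ Icc P.t₀ P.T, ‖DS k t‖ ≤ B := fun k hk t ht =>
    (norm_fst_le _).trans (hB k hk t ht)
  have hBF : ∀ k ≤ p + 1, ∀ t ∈ Icc P.t₀ P.T, ‖DF k t‖ ≤ B := fun k hk t ht =>
    (norm_snd_le _).trans (hB k hk t ht)
  -- With the state arguments swapped, one integration lemma serves both components.
  have hfF' : ContDiff ℝ p (fun z : ℝ × EF × ES => P.fF z.1 z.2.2 z.2.1) :=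
    hP.2.comp (contDiff_fst.prodMk ((contDiff_snd.comp contDiff_snd).prodMk
      (contDiff_fst.comp contDiff_snd)))
  -- Extrapolation: this is applied with b = a + H, the spline window preceding the integration
  -- window. For the fast part below the two windows coincide.
  obtain ⟨cS, HS, hcS, hHS, hslow⟩ := exists_waveform_integration_bound (k := 1) le_rfl hp hq hΦS hRF
    (f := P.fS) hP.1 (x := uS) (D := DF) (B := B) (t₀ := P.t₀) (T := P.T)
    (fun t ht => by
      have h := hDSd 0 (by lia) t ht
      rwa [hDS0, hDS1, ← hDF0] at h)
    (fun t ht => by rw [← hDS0]; exact hBS 0 (by lia) t ht)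
    (fun t ht => by
      have h := hBS 1 (by lia) t ht
      rwa [hDS1, ← hDF0] at h) hDFd hBF
  obtain ⟨cF, HF, hcF, hHF, hfast⟩ := exists_waveform_integration_bound (k := m) hm hp hq hΦF hRS
    (f := fun t x y => P.fF t y x) hfF' (x := uF) (D := DS) (B := B) (t₀ := P.t₀) (T := P.T)
    (fun t ht => by
      have h := hDFd 0 (by lia) t ht
      rwa [hDF0, hDF1, ← hDS0] at h)
    (fun t ht => by rw [← hDF0]; exact hBF 0 (by lia) t ht)
    (fun t ht => by
      have h := hBF 1 (by lia) t ht
      rwa [hDF1, ← hDS0] at h) hDSd hBS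
  rw [hDF0] at hslow
  rw [hDS0] at hfast
  set ρ := |P.t₀| + |P.T| + |B| + 2 with hρ
  obtain ⟨Λ₁, hΛ₁0, hΛ₁⟩ := hP.1.exists_norm_sub_le_mul hp ρ
  obtain ⟨Λ₂, hΛ₂0, hΛ₂⟩ := hP.2.exists_norm_sub_le_mul hp ρ
  -- In multiples of HG, c1 and c3 bound the change of the slow and fast errors. In multiples of G,
  -- c2 bounds the errors of all interpolation data, including the end slope taken at the
  -- extrapolated fast value.
  set c1 := cS * (Λ₂ + 3) with hc1
  set c2 := 2 + Λ₁ * (2 + cS * (Λ₂ + 2)) with hc2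
  set c3 := cF * (c2 + 2) with hc3
  have hc10 : 0 ≤ c1 := by positivity
  have hc20 : 0 ≤ c2 := by positivity
  have hc30 : 0 ≤ c3 := by positivity
  -- The sum dominates every constant for which smallness is needed; the 8 provides G ≤ 1/8.
  set c := 8 + c1 + c2 + c3 + Λ₂ with hc
  refine ⟨c, min (min HS HF) (1 / c), by linarith, by positivity, ?_⟩
  intro a b b' H G y₀ y₁ y₂ z wF wS hH hHle hta hb hb' hbT hG hcG hcHG hy₀ hy₁ hz hzinc hRwF hy₂ hRwS
  have hHHS : H ≤ HS := hHle.trans ((min_le_left _ _).trans (min_le_left _ _))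
  have hHHF : H ≤ HF := hHle.trans ((min_le_left _ _).trans (min_le_right _ _))
  have hHc : H ≤ 1 / c := hHle.trans (min_le_right _ _)
  have hcpos : 0 < c := by positivity
  rw [le_div_iff₀ hcpos] at hHc
  have hr0 : 0 ≤ H ^ min p q := by positivity
  have hG0 : 0 ≤ G := hr0.trans hG
  have hHG0 : 0 ≤ H * G := by positivity
  have hle : ∀ c', c' ≤ c → c' * G ≤ 1 ∧ c' * (H * G) ≤ H ^ min p q ∧ c' * H ≤ 1 := fun c' h =>
    ⟨(mul_le_mul_of_nonneg_right h hG0).trans hcG,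
      (mul_le_mul_of_nonneg_right h hHG0).trans hcHG,
      by linarith [mul_le_mul_of_nonneg_right h hH.le]⟩
  have hm' : (1 : ℝ) ≤ m := by exact_mod_cast hm
  have hlast : a + ((Fin.last m : Fin (m + 1)) : ℝ) * (H / m) = b := by
    rw [Fin.val_last, hb]; field_simp
  have hzlast : ‖z (Fin.last m) - uF b‖ ≤ G := by
    have := hz (Fin.last m)
    rwa [hlast] at this
  have hz0 : ‖z 0 - uF a‖ ≤ G := by simpa using hz 0
  have ha_mem : a ∈ Icc P.t₀ P.T := ⟨hta, by linarith⟩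
  have hb_mem : b ∈ Icc P.t₀ P.T := ⟨by linarith, by linarith⟩
  have hb'_mem : b' ∈ Icc P.t₀ P.T := ⟨by linarith, hbT⟩
  -- slopes at perturbed data
  have hball : ∀ t ∈ Icc P.t₀ P.T, ∀ (x : ES) (y : EF), ‖x - uS t‖ ≤ 1 → ‖y - uF t‖ ≤ 1 →
      ‖(t, x, y)‖ ≤ ρ ∧ ‖(t, uS t, uF t)‖ ≤ ρ := by
    intro t ht x y hx hy
    have h1 : |t| ≤ |P.t₀| + |P.T| :=
      (abs_le_max_abs_abs ht.1 ht.2).trans (max_le_add_of_nonneg (abs_nonneg _) (abs_nonneg _))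
    have h2 : ‖uS t‖ ≤ B := by rw [← hDS0]; exact hBS 0 (by lia) t ht
    have h3 : ‖uF t‖ ≤ B := by rw [← hDF0]; exact hBF 0 (by lia) t ht
    have h4 := le_abs_self B
    have h5 := abs_nonneg B
    have h6 := abs_nonneg P.t₀
    have h7 := abs_nonneg P.T
    refine ⟨norm_prod_le_iff.2 ⟨?_, norm_prod_le_iff.2 ⟨?_, ?_⟩⟩,
      norm_prod_le_iff.2 ⟨?_, norm_prod_le_iff.2 ⟨?_, ?_⟩⟩⟩
    · show |t| ≤ ρ; linarith
    · show ‖x‖ ≤ ρ; linarith [norm_le_norm_sub_add x (uS t)]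
    · show ‖y‖ ≤ ρ; linarith [norm_le_norm_sub_add y (uF t)]
    · show |t| ≤ ρ; linarith
    · show ‖uS t‖ ≤ ρ; linarith
    · show ‖uF t‖ ≤ ρ; linarith
  have hdist : ∀ (t ε : ℝ) (x : ES) (y : EF), ‖x - uS t‖ ≤ ε → ‖y - uF t‖ ≤ ε →
      ‖(t, x, y) - (t, uS t, uF t)‖ ≤ ε := by
    intro t ε x y hx hy
    rw [Prod.mk_sub_mk, Prod.mk_sub_mk, sub_self]
    refine norm_prod_le_iff.2 ⟨?_, norm_prod_le_iff.2 ⟨hx, hy⟩⟩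
    rw [norm_zero]; exact (norm_nonneg _).trans hx
  have hslopeS : ∀ t ∈ Icc P.t₀ P.T, ∀ (ε : ℝ) (x : ES) (y : EF), ε ≤ 1 → ‖x - uS t‖ ≤ ε →
      ‖y - uF t‖ ≤ ε → ‖P.fS t x y - DS 1 t‖ ≤ Λ₁ * ε := by
    intro t ht ε x y hε hx hy
    have h := hball t ht x y (hx.trans hε) (hy.trans hε)
    rw [hDS1]
    exact (hΛ₁ _ _ h.1 h.2).trans (mul_le_mul_of_nonneg_left (hdist t ε x y hx hy) hΛ₁0)
  have hslopeF : ∀ t ∈ Icc P.t₀ P.T, ∀ (ε : ℝ) (x : ES) (y : EF), ε ≤ 1 → ‖x - uS t‖ ≤ ε →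
      ‖y - uF t‖ ≤ ε → ‖P.fF t x y - DF 1 t‖ ≤ Λ₂ * ε := by
    intro t ht ε x y hε hx hy
    have h := hball t ht x y (hx.trans hε) (hy.trans hε)
    rw [hDF1]
    exact (hΛ₂ _ _ h.1 h.2).trans (mul_le_mul_of_nonneg_left (hdist t ε x y hx hy) hΛ₂0)
  have hG1 : 8 * G ≤ 1 := (hle 8 (by linarith)).1
  -- slow step
  have hη₁ : G ≤ (Λ₂ + 1) * G := by linarith only [mul_nonneg hΛ₂0 hG0]
  have hη₁' : Λ₂ * G ≤ (Λ₂ + 1) * G := by linarith only [hG0]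
  have hcSG : cS * ((Λ₂ + 1) * G + H ^ min p q) ≤ cS * (Λ₂ + 2) * G := by
    have : cS * H ^ min p q ≤ cS * G := by gcongr
    linarith
  have hcSle : cS * (Λ₂ + 2) ≤ c := by
    have : cS * (Λ₂ + 2) ≤ c1 := by rw [hc1]; gcongr; norm_num
    linarith
  obtain ⟨hwF, hS⟩ := hslow a b H ((Λ₂ + 1) * G) z _ _ wF y₁ hH hHHS hta (by linarith) hb.le
    (by linarith) hRwF (fun i => (hz i).trans hη₁)
    ((hslopeF a ha_mem G y₀ (z 0) (by linarith) hy₀ hz0).trans hη₁')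
    (by rw [← hb]; exact (hslopeF b hb_mem G y₁ _ (by linarith) hy₁ hzlast).trans hη₁') hzinc
    (by have := (hle (Λ₂ + 1) (by linarith)).2.1; linarith)
    (hle (Λ₂ + 1) (by linarith)).1 (by linarith) (hcSG.trans (hle _ hcSle).1)
  have hSinc : ‖(y₂ - uS b') - (y₁ - uS b)‖ ≤ c1 * (H * G) := by
    have h := hS 1 le_rfl
    simp only [OneStep.steps, Nat.cast_zero, Nat.cast_one, zero_mul, add_zero, div_one,
      one_mul] at h
    rw [← hy₂, ← hb'] at h
    refine h.trans ?_
    rw [hc1, mul_assoc cS H, mul_assoc cS (Λ₂ + 3)]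
    refine mul_le_mul_of_nonneg_left ?_ hcS
    rw [mul_left_comm]
    refine mul_le_mul_of_nonneg_left ?_ hH.le
    linarith
  have hy₂G : ‖y₂ - uS b'‖ ≤ 2 * G := by
    have h1 := norm_le_norm_sub_add (y₂ - uS b') (y₁ - uS b)
    have h2 : c1 * (H * G) ≤ G := by
      have := mul_le_mul_of_nonneg_right (hle c1 (by linarith)).2.2 hG0
      linarith
    linarith
  -- interpolation and fast steps
  have hwFb' : ‖wF b' - uF b'‖ ≤ cS * (Λ₂ + 2) * G :=
    (hwF b' ⟨by linarith, hb'.le⟩).trans hcSG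
  have hcSΛ : 0 ≤ cS * (Λ₂ + 2) := by positivity
  have hΛ₁cSΛ := mul_nonneg hΛ₁0 hcSΛ
  have h2c2 : 2 ≤ c2 := by rw [hc2]; linarith only [hΛ₁0, hΛ₁cSΛ]
  have hΛ₁c2 : Λ₁ ≤ c2 := by rw [hc2]; linarith only [hΛ₁0, hΛ₁cSΛ]
  have hd₀ : ‖P.fS b y₁ (z (Fin.last m)) - DS 1 b‖ ≤ c2 * G := by
    refine (hslopeS b hb_mem G y₁ _ (by linarith) hy₁ hzlast).trans ?_
    refine mul_le_mul_of_nonneg_right ?_ hG0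
    exact hΛ₁c2
  have hd₁ : ‖P.fS b' y₂ (wF b') - DS 1 b'‖ ≤ c2 * G := by
    have h1 : (2 + cS * (Λ₂ + 2)) * G ≤ 1 := by
      refine (hle _ ?_).1
      have : cS * (Λ₂ + 2) ≤ c1 := by rw [hc1]; gcongr; norm_num
      linarith
    have h2 : 0 ≤ cS * (Λ₂ + 2) * G := by positivity
    refine (hslopeS b' hb'_mem ((2 + cS * (Λ₂ + 2)) * G) y₂ _ h1 (by linarith)
      (by linarith)).trans ?_
    rw [hc2]; linarith
  have hvals : ∀ i : Fin 2, ‖(![y₁, y₂] i - uS (b + (i : ℝ) * (H / (1 : ℕ))))‖ ≤ c2 * G ∧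
      ‖(![y₁, y₂] i - uS (b + (i : ℝ) * (H / (1 : ℕ)))) - (![y₁, y₂] 0 - uS b)‖ ≤ H ^ min p q := by
    have h2G : 2 * G ≤ c2 * G := by
      exact mul_le_mul_of_nonneg_right h2c2 hG0
    intro i
    fin_cases i
    · simp only [Fin.zero_eta, Matrix.cons_val_zero, Nat.cast_zero, zero_mul, add_zero,
        sub_self, norm_zero]
      exact ⟨by linarith, hr0⟩
    · simp only [Fin.mk_one, Matrix.cons_val_one, Matrix.cons_val_zero, Nat.cast_one,
        div_one, one_mul, ← hb']
      exact ⟨hy₂G.trans h2G, hSinc.trans (hle c1 (by linarith)).2.1⟩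
  have hcFG : cF * (c2 * G + H ^ min p q) ≤ c3 * G := by
    have h1 : cF * H ^ min p q ≤ cF * G := by gcongr
    have h2 : 0 ≤ cF * G := by positivity
    rw [hc3]; linarith
  obtain ⟨-, hF⟩ := hfast b b H (c2 * G) ![y₁, y₂] _ _ wS (z (Fin.last m)) hH hHHF (by linarith)
    le_rfl (by linarith) (by linarith) hRwS (fun i => (hvals i).1) hd₀ (by rw [← hb']; exact hd₁)
    (fun i => (hvals i).2) (by have := (hle c2 (by linarith)).2.1; linarith)
    (hle c2 (by linarith)).1 (by linarith) (hcFG.trans (hle c3 (by linarith)).1)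
  refine ⟨hSinc.trans (mul_le_mul_of_nonneg_right (by linarith) hHG0), fun i hi => ?_⟩
  refine (hF i hi).trans ?_
  have h1 : cF * H * (‖z (Fin.last m) - uF b‖ + c2 * G + H ^ min p q) ≤ c3 * (H * G) := by
    have h2 : ‖z (Fin.last m) - uF b‖ + c2 * G + H ^ min p q ≤ (c2 + 2) * G := by linarith
    have h3 := mul_le_mul_of_nonneg_left h2 (by positivity : 0 ≤ cF * H)
    rw [hc3]; linarith
  exact h1.trans (mul_le_mul_of_nonneg_right (by linarith) hHG0)

end Window

/-! ### Existence of runs and global error -/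

section Convergence

open Set

/-- A scheme whose spline rules always produce a waveform can be carried out. -/
theorem MultirateScheme.exists_isRun {m : ℕ} {ES EF : Type*} [NormedAddCommGroup ES]
    [NormedSpace ℝ ES] [NormedAddCommGroup EF] [NormedSpace ℝ EF] (hm : 1 ≤ m)
    (A : MultirateScheme m ES EF)
    (hextrap : ∀ a H v d₀ d₁, 0 < H → ∃ w, A.extrap a H v d₀ d₁ w)
    (hinterp : ∀ a H v d₀ d₁, 0 < H → ∃ w, A.interp a H v d₀ d₁ w)
    (P : PartitionedIVP ES EF) {H : ℝ} (hH : 0 < H) (N : ℕ) :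
    ∃ yS yF wS wF, A.IsRun P H N yS yF wS wF := by
  choose WF hWF using fun a v d₀ d₁ => hextrap a H v d₀ d₁ hH
  choose WS hWS using fun a v d₀ d₁ => hinterp a H v d₀ d₁ hH
  let t : ℕ → ℝ := fun n => P.t₀ + n * H
  let wF : ℕ → ES × ES × (ℕ → EF) → ℝ → EF := fun n σ =>
    WF (t n) (fun i => σ.2.2 i) (P.fF (t n) σ.1 (σ.2.2 0)) (P.fF (t (n + 1)) σ.2.1 (σ.2.2 m))
  let x₂ : ℕ → ES × ES × (ℕ → EF) → ES := fun n σ =>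
    A.slow (fun s x => P.fS s x (wF n σ s)) (t (n + 1)) H σ.2.1
  let wS : ℕ → ES × ES × (ℕ → EF) → ℝ → ES := fun n σ =>
    WS (t (n + 1)) ![σ.2.1, x₂ n σ] (P.fS (t (n + 1)) σ.2.1 (σ.2.2 m))
      (P.fS (t (n + 2)) (x₂ n σ) (wF n σ (t (n + 2))))
  let next : ℕ → ES × ES × (ℕ → EF) → ES × ES × (ℕ → EF) := fun n σ =>
    (σ.2.1, x₂ n σ, A.fast.steps (fun s x => P.fF s (wS n σ s) x) (t (n + 1)) (H / m) (σ.2.2 m))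
  -- The state of window n holds the slow values at both of its ends and the fast values inside it,
  -- which is all that the next window needs.
  let σ : ℕ → ES × ES × (ℕ → EF) := fun n => Nat.rec
    (P.initS, (A.start.steps P.full P.t₀ (H / m) (P.initS, P.initF) m).1,
      fun k => (A.start.steps P.full P.t₀ (H / m) (P.initS, P.initF) k).2) next n
  have hσ : ∀ n, σ (n + 1) = next n (σ n) := fun n => rfl
  -- The case i = m is the shared node: division assigns it to window n + 1 at position 0, where the
  -- stored value is the last one of window n.
  have hyF : ∀ n, ∀ i ≤ m, (σ ((n * m + i) / m)).2.2 ((n * m + i) % m) = (σ n).2.2 i := by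
    intro n i hi
    rcases hi.lt_or_eq with hi | rfl
    · rw [add_comm, Nat.add_mul_div_right _ _ (by lia), Nat.add_mul_mod_self_right,
        Nat.div_eq_of_lt hi, Nat.mod_eq_of_lt hi, zero_add]
    · have h1 : n * i + i = (n + 1) * i := by ring
      rw [h1, Nat.mul_div_cancel _ (by lia), Nat.mul_mod_left, hσ]
      rfl
  have hyF0 : ∀ n, (σ (n * m / m)).2.2 (n * m % m) = (σ n).2.2 0 := fun n => hyF n 0 (Nat.zero_le _)
  have hyFm : ∀ n, (σ ((n + 1) * m / m)).2.2 ((n + 1) * m % m) = (σ n).2.2 m := fun n => by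
    rw [Nat.succ_mul]; exact hyF n m le_rfl
  refine ⟨fun n => (σ n).1, fun k => (σ (k / m)).2.2 (k % m),
    fun n => wS (n - 1) (σ (n - 1)), fun n => wF (n - 1) (σ (n - 1)), ?_⟩
  constructor
  · rfl
  · intro k hk
    have := hyF 0 k hk
    rw [zero_mul, zero_add] at this
    exact this
  · rfl
  · intro n _
    simp only [hyF0, Nat.add_sub_cancel]
    have h1 : (fun i : Fin (m + 1) => (σ ((n * m + i) / m)).2.2 ((n * m + i) % m))
        = fun i : Fin (m + 1) => (σ n).2.2 i :=
      funext fun i => hyF n i (Nat.lt_succ_iff.1 i.2)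
    rw [h1]
    exact hWF _ _ _ _
  · intro n _
    rfl
  · intro n _
    simp only [hyFm, Nat.add_sub_cancel]
    exact hWS _ _ _ _
  · intro n _ i hi
    have h1 := hyF (n + 1) (i + 1) hi
    have h2 := hyF (n + 1) i hi.le
    rw [← add_assoc] at h1
    simp only [h1, h2]
    rfl

variable {ES EF : Type*} [NormedAddCommGroup ES] [NormedSpace ℝ ES] [ProperSpace ES]
  [NormedAddCommGroup EF] [NormedSpace ℝ EF] [ProperSpace EF]

theorem MultirateScheme.IsRun.fast_eq_steps {m : ℕ} {ES EF : Type*} [NormedAddCommGroup ES]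
    [NormedSpace ℝ ES] [NormedAddCommGroup EF] [NormedSpace ℝ EF] {A : MultirateScheme m ES EF}
    {P : PartitionedIVP ES EF} {H : ℝ} {N : ℕ} {yS : ℕ → ES} {yF : ℕ → EF} {wS : ℕ → ℝ → ES}
    {wF : ℕ → ℝ → EF} (hrun : A.IsRun P H N yS yF wS wF) {n : ℕ} (hn : n + 2 ≤ N) :
    ∀ i ≤ m, yF ((n + 1) * m + i) = A.fast.steps (fun t x => P.fF t (wS (n + 1) t) x)
      (P.t₀ + (n + 1 : ℕ) * H) (H / m) (yF ((n + 1) * m)) i := by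
  intro i
  induction i with
  | zero => intro _; rfl
  | succ i ih =>
    intro hi
    rw [← add_assoc, hrun.fast_steps n hn i hi, ih (by lia)]
    rfl

/-- Error bound for all runs of a multirate scheme. -/
theorem MultirateScheme.exists_error_le {m p q : ℕ} (hm : 1 ≤ m) (hp : 1 ≤ p) (hq : 1 ≤ q)
    {A : MultirateScheme m ES EF} (hslow : A.slow.HasOrder p) (hfast : A.fast.HasOrder p)
    (hstart : A.start.HasOrder p) (hextrap : A.extrap.HasOrder q) (hinterp : A.interp.HasOrder q)
    {P : PartitionedIVP ES EF} {uS : ℝ → ES} {uF : ℝ → EF} (hT : P.t₀ < P.T) (hP : P.Smooth p)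
    (hu : P.IsSolution uS uF) :
    ∃ C H₀ : ℝ, 0 < H₀ ∧ ∀ (H : ℝ) (N : ℕ), 0 < H → H ≤ H₀ → 1 ≤ N → P.t₀ + N * H ≤ P.T →
      ∀ yS yF wS wF, A.IsRun P H N yS yF wS wF →
        (∀ n ≤ N, ‖yS n - uS (P.t₀ + n * H)‖ ≤ C * H ^ min p q) ∧
        ∀ k ≤ N * m, ‖yF k - uF (P.t₀ + k * (H / m))‖ ≤ C * H ^ min p q := by
  obtain ⟨c₀, H₀, hc₀, hH₀, hinit⟩ : ∃ c H₀ : ℝ, 0 ≤ c ∧ 0 < H₀ ∧ ∀ H, 0 < H → H ≤ H₀ →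
      P.t₀ + H ≤ P.T → ∀ i ≤ m, ‖A.start.steps P.full P.t₀ (H / m) (P.initS, P.initF) i
        - (uS (P.t₀ + i * (H / m)), uF (P.t₀ + i * (H / m)))‖ ≤ c * (H * H ^ p) := by
    obtain ⟨h1, h2, hsol⟩ := hu
    obtain ⟨D, B, hD0, hD1, hD, hB⟩ := SolvesODE.exists_derivative_chain hT hP.contDiff_full hsol
    have := exists_start_bound hm hp hstart hP.contDiff_full hsol (B := B)
      (fun t ht => by rw [← hD1]; exact hB 1 (by lia) t ht)
    simpa only [h1, h2] using this
  obtain ⟨c₁, H₁, hc₁, hH₁, hwin⟩ :=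
    exists_window_bound hm hp hq hslow hfast hextrap hinterp hT hP hu
  set c := c₁ + c₀ with hc
  have hcpos : 0 < c := by positivity
  set K := Real.exp (c * (P.T - P.t₀)) with hK
  have hKpos : 0 < K := Real.exp_pos _
  -- K may enter the step size bound because c was fixed before it. The condition c K H ≤ 1 is what
  -- gives the variation of the error the bound H^r with constant one.
  refine ⟨K, min (min H₀ H₁) (min 1 (1 / (c * K))), by positivity, ?_⟩
  intro H N hH hHle hN hNT yS yF wS wF hrun
  have hHH₀ : H ≤ H₀ := hHle.trans ((min_le_left _ _).trans (min_le_left _ _))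
  have hHH₁ : H ≤ H₁ := hHle.trans ((min_le_left _ _).trans (min_le_right _ _))
  have hH1 : H ≤ 1 := hHle.trans ((min_le_right _ _).trans (min_le_left _ _))
  have hHcK : H ≤ 1 / (c * K) := hHle.trans ((min_le_right _ _).trans (min_le_right _ _))
  rw [le_div_iff₀ (by positivity)] at hHcK
  set r := min p q with hr
  have hHr0 : 0 < H ^ r := by positivity
  have hHrH : H ^ r ≤ H := pow_le_of_le_one hH.le hH1 (by lia)
  have hmpos : (0 : ℝ) < m := by exact_mod_cast hm
  set G : ℕ → ℝ := fun n => (1 + c * H) ^ n * H ^ r with hG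
  have hGpos : ∀ n, 0 < G n := fun n => by positivity
  have hGr : ∀ n, H ^ r ≤ G n := fun n =>
    le_mul_of_one_le_left hHr0.le (one_le_pow₀ (by linarith [mul_pos hcpos hH]))
  have hGsucc : ∀ n, G (n + 1) = G n + c * (H * G n) := fun n => by
    simp only [hG, pow_succ]; ring
  have hGmono : ∀ n, G n ≤ G (n + 1) := fun n => by
    rw [hGsucc]; linarith [mul_pos hcpos (mul_pos hH (hGpos n))]
  have hGK : ∀ n ≤ N, G n ≤ K * H ^ r := by
    intro n hn
    refine mul_le_mul_of_nonneg_right ?_ hHr0.le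
    have h1 : 1 + c * H ≤ Real.exp (c * H) := by linarith [Real.add_one_le_exp (c * H)]
    have h2 : (n : ℝ) ≤ N := by exact_mod_cast hn
    calc (1 + c * H) ^ n ≤ Real.exp (c * H) ^ n := pow_le_pow_left₀ (by positivity) h1 n
      _ = Real.exp (c * (n * H)) := by rw [← Real.exp_nat_mul]; ring_nf
      _ ≤ K := by
        refine Real.exp_le_exp.2 (mul_le_mul_of_nonneg_left ?_ hcpos.le)
        have : (n : ℝ) * H ≤ N * H := by gcongr
        linarith
  have hcHG : ∀ n ≤ N, c * (H * G n) ≤ H ^ r := by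
    intro n hn
    have h1 : c * (H * G n) ≤ c * (H * (K * H ^ r)) := by gcongr; exact hGK n hn
    have h2 : H * (c * K) * H ^ r ≤ 1 * H ^ r := by gcongr
    linarith
  have hcG : ∀ n ≤ N, c * G n ≤ 1 := by
    intro n hn
    have h1 : c * G n ≤ c * (K * H) := by gcongr; exact (hGK n hn).trans (by gcongr)
    linarith
  have htime : ∀ n i : ℕ, P.t₀ + ((n * m + i : ℕ) : ℝ) * (H / m) = P.t₀ + n * H + i * (H / m) := by
    intro n i; push_cast; field_simp; ring
  -- The third conjunct, the variation of the fast error inside the last window, must be part of the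
  -- induction: the next extrapolation needs it to bound the derivatives of its waveform.
  have main : ∀ n, n + 1 ≤ N →
      (∀ j ≤ n + 1, ‖yS j - uS (P.t₀ + j * H)‖ ≤ G (n + 1)) ∧
      (∀ k ≤ (n + 1) * m, ‖yF k - uF (P.t₀ + k * (H / m))‖ ≤ G (n + 1)) ∧
      ∀ i ≤ m, ‖(yF (n * m + i) - uF (P.t₀ + n * H + i * (H / m)))
        - (yF (n * m) - uF (P.t₀ + n * H))‖ ≤ H ^ r := by
    intro n
    induction n with
    | zero =>
      intro hn
      have hN1 : (1 : ℝ) ≤ N := by exact_mod_cast hn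
      have hinit := hinit H hH hHH₀ (by nlinarith)
      have hsmall : c₀ * (H * H ^ p) ≤ c * (H * G 0) := by
        have h1 : H ^ p ≤ G 0 :=
          (pow_le_pow_of_le_one hH.le hH1 (min_le_left _ _)).trans (hGr 0)
        gcongr
        linarith
      have hG1 : c * (H * G 0) ≤ G 1 := by rw [hGsucc]; linarith [hGpos 0]
      have hF : ∀ k ≤ m, ‖yF k - uF (P.t₀ + k * (H / m))‖ ≤ c * (H * G 0) := by
        intro k hk
        rw [hrun.first_fast k hk]
        exact (norm_snd_le _).trans ((hinit k hk).trans hsmall)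
      have hF0 : yF 0 - uF P.t₀ = 0 := by
        rw [hrun.first_fast 0 (Nat.zero_le _), hu.2.1]
        simp [OneStep.steps]
      refine ⟨?_, ?_, ?_⟩
      · intro j hj
        interval_cases j
        · rw [hrun.init_slow, Nat.cast_zero, zero_mul, add_zero, hu.1, sub_self, norm_zero]
          exact (hGpos _).le
        · have h1 := (norm_fst_le _).trans ((hinit m le_rfl).trans hsmall)
          have h2 : (m : ℝ) * (H / m) = H := by field_simp
          rw [h2] at h1
          rw [hrun.first_slow, Nat.cast_one, one_mul]
          exact h1.trans hG1
      · intro k hk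
        exact (hF k (by lia)).trans hG1
      · intro i hi
        simp only [zero_mul, zero_add, Nat.cast_zero, add_zero, hF0, sub_zero]
        exact (hF i hi).trans (hcHG 0 (by lia))
    | succ n ih =>
      intro hn
      obtain ⟨ihS, ihF, ihI⟩ := ih (by lia)
      have hnN : ((n + 2 : ℕ) : ℝ) ≤ N := by exact_mod_cast hn
      have hlastF : n * m + m = (n + 1) * m := by ring
      have hw := hwin (P.t₀ + n * H) (P.t₀ + (n + 1 : ℕ) * H) (P.t₀ + (n + 2 : ℕ) * H) H (G (n + 1))
        (yS n) (yS (n + 1)) (yS (n + 2)) (fun i => yF (n * m + i)) (wF (n + 1)) (wS (n + 1)) hH hHH₁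
        (by linarith [mul_nonneg (Nat.cast_nonneg n : (0 : ℝ) ≤ n) hH.le])
        (by push_cast; ring) (by push_cast; ring)
        (by linarith [mul_le_mul_of_nonneg_right hnN hH.le]) (hGr _)
        ((mul_le_mul_of_nonneg_right (by linarith) (hGpos _).le).trans (hcG (n + 1) (by lia)))
        ((mul_le_mul_of_nonneg_right (by linarith) (mul_pos hH (hGpos _)).le).trans
          (hcHG (n + 1) (by lia)))
        (ihS n (by lia)) (ihS (n + 1) le_rfl)
        (fun i => by
          rw [← htime]
          exact ihF _ (by have := i.2; rw [← hlastF]; lia))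
        (fun i => by
          simpa using ihI i (Nat.lt_succ_iff.1 i.2))
        (by
          have := hrun.extrapolate n hn
          simpa only [Fin.val_zero, add_zero, Fin.val_last, hlastF] using this)
        (hrun.slow_step n hn)
        (by
          have := hrun.interpolate n hn
          simpa only [Fin.val_last, hlastF] using this)
      simp only [Fin.val_last, hlastF] at hw
      obtain ⟨hwS, hwF⟩ := hw
      have hc₁le : c₁ * (H * G (n + 1)) ≤ c * (H * G (n + 1)) :=
        mul_le_mul_of_nonneg_right (by linarith) (mul_pos hH (hGpos _)).le
      have hincF : ∀ i ≤ m, ‖(yF ((n + 1) * m + i) - uF (P.t₀ + (n + 1 : ℕ) * H + i * (H / m)))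
          - (yF ((n + 1) * m) - uF (P.t₀ + (n + 1 : ℕ) * H))‖ ≤ c * (H * G (n + 1)) := by
        intro i hi
        rw [hrun.fast_eq_steps hn i hi]
        exact (hwF i hi).trans hc₁le
      refine ⟨?_, ?_, fun i hi => (hincF i hi).trans (hcHG _ (by lia))⟩
      · intro j hj
        rcases Nat.lt_or_ge j (n + 2) with h | h
        · exact (ihS j (by lia)).trans (hGmono _)
        · obtain rfl : j = n + 2 := by lia
          rw [hGsucc]
          have h1 := norm_le_norm_sub_add (yS (n + 2) - uS (P.t₀ + (n + 2 : ℕ) * H))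
            (yS (n + 1) - uS (P.t₀ + (n + 1 : ℕ) * H))
          linarith [ihS (n + 1) le_rfl]
      · intro k hk
        rcases Nat.lt_or_ge ((n + 1) * m) k with h | h
        · obtain ⟨i, rfl⟩ := Nat.exists_eq_add_of_le h.le
          have hi : i ≤ m := by
            have : (n + 1 + 1) * m = (n + 1) * m + m := by ring
            lia
          rw [hGsucc, htime]
          have h1 := norm_le_norm_sub_add
            (yF ((n + 1) * m + i) - uF (P.t₀ + (n + 1 : ℕ) * H + i * (H / m)))
            (yF ((n + 1) * m) - uF (P.t₀ + (n + 1 : ℕ) * H))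
          have h2 := ihF ((n + 1) * m) le_rfl
          have h3 := htime (n + 1) 0
          simp only [add_zero, Nat.cast_zero, zero_mul] at h3
          rw [h3] at h2
          linarith [hincF i hi]
        · exact (ihF k h).trans (hGmono _)
  obtain ⟨n, rfl⟩ : ∃ n, N = n + 1 := ⟨N - 1, by lia⟩
  obtain ⟨hS, hF, -⟩ := main n le_rfl
  exact ⟨fun j hj => (hS j hj).trans (hGK _ le_rfl), fun k hk => (hF k hk).trans (hGK _ le_rfl)⟩

theorem SplineRule.HasOrder.exists_waveform {m q : ℕ} {E : Type*} [NormedAddCommGroup E]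
    [NormedSpace ℝ E] {R : SplineRule m E} (hR : R.HasOrder q) (a H : ℝ) (v : Fin (m + 1) → E)
    (d₀ d₁ : E) (hH : 0 < H) : ∃ w, R a H v d₀ d₁ w := by
  obtain ⟨ω, δ₀, δ₁, -, -, -, -, h⟩ := hR
  exact ⟨_, (h a H v d₀ d₁ _ hH).2 fun t => rfl⟩

/-- Order of the multirate scheme with general spline rules. -/
theorem MultirateScheme.hasOrder_min {m p q : ℕ} (hm : 1 ≤ m) (hp : 1 ≤ p) (hq : 1 ≤ q)
    {A : MultirateScheme m ES EF} (hslow : A.slow.HasOrder p) (hfast : A.fast.HasOrder p)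
    (hstart : A.start.HasOrder p) (hextrap : A.extrap.HasOrder q) (hinterp : A.interp.HasOrder q) :
    A.HasOrder p (min p q) := by
  intro P uS uF hT hP hu
  obtain ⟨C, H₀, hH₀, h⟩ := exists_error_le hm hp hq hslow hfast hstart hextrap hinterp hT hP hu
  exact ⟨C, H₀, hH₀, fun H N hH hHle hN hNT => ⟨A.exists_isRun hm hextrap.exists_waveform
    hinterp.exists_waveform P hH N, h H N hH hHle hN hNT⟩⟩

theorem MultirateScheme.HasOrder.isConvergent {m k r : ℕ} {ES EF : Type*} [NormedAddCommGroup ES]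
    [NormedSpace ℝ ES] [NormedAddCommGroup EF] [NormedSpace ℝ EF] {A : MultirateScheme m ES EF}
    (hr : 1 ≤ r) (hA : A.HasOrder k r) : A.IsConvergent k := by
  intro P uS uF hT hP hu ε hε
  obtain ⟨C, H₀, hH₀, h⟩ := hA P uS uF hT hP hu
  refine ⟨min H₀ (min 1 (ε / (|C| + 1))), by positivity, fun H N hH hHle hN hNT => ?_⟩
  have hHH₀ : H ≤ H₀ := hHle.trans (min_le_left _ _)
  have hH1 : H ≤ 1 := hHle.trans ((min_le_right _ _).trans (min_le_left _ _))
  have hHε : H ≤ ε / (|C| + 1) := hHle.trans ((min_le_right _ _).trans (min_le_right _ _))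
  rw [le_div_iff₀ (by positivity)] at hHε
  have hCε : C * H ^ r ≤ ε := by
    have h1 : C * H ^ r ≤ |C| * H :=
      mul_le_mul (le_abs_self C) (pow_le_of_le_one hH.le hH1 (by lia)) (by positivity)
        (abs_nonneg C)
    linarith
  obtain ⟨hex, herr⟩ := h H N hH hHH₀ hN hNT
  refine ⟨hex, fun yS yF wS wF hrun => ?_⟩
  obtain ⟨h1, h2⟩ := herr yS yF wS wF hrun
  exact ⟨fun n hn => (h1 n hn).trans hCε, fun k hk => (h2 k hk).trans hCε⟩

end Convergence

/-! ### Uniqueness of the clamped cubic spline -/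

section ClampedSplineUniqueness

open Set

/-- The energy argument in discrete form. On a cubic piece vanishing at both ends, s''' is constant
and s' has mean zero, so the integral of s''² is the increment of s'' s'. These increments are
nonnegative and telescope to zero by the clamped ends. Hence all nodal slopes vanish, and a cubic
with zero values and slopes at both ends is zero. -/
theorem IsClampedCubicSpline.eqOn_zero {m : ℕ} (hm : 1 ≤ m) {a H : ℝ} (hH : 0 < H) {s : ℝ → ℝ}
    (hs : IsClampedCubicSpline (m := m) a H 0 0 0 s) : ∀ t ∈ Icc a (a + H), s t = 0 := by
  set I := Icc a (a + H) with hI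
  have hU : UniqueDiffOn ℝ I := uniqueDiffOn_Icc (by linarith)
  have hC := (contDiffOn_succ_iff_derivWithin (n := 1) hU).1 (by
    rw [one_add_one_eq_two]; exact hs.contDiff)
  have hd1 : ∀ t ∈ I, HasDerivWithinAt s (derivWithin s I t) I t :=
    fun t ht => (hC.1 t ht).hasDerivWithinAt
  have hd2 : ∀ t ∈ I, HasDerivWithinAt (derivWithin s I) (derivWithin (derivWithin s I) I t) I t :=
    fun t ht => (hC.2.2.differentiableOn (by norm_num) t ht).hasDerivWithinAt
  set s₁ := derivWithin s I with hs₁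
  set s₂ := derivWithin s₁ I with hs₂
  have hm' : (0 : ℝ) < m := by exact_mod_cast hm
  set l := H / m with hl
  have hl0 : 0 < l := by positivity
  have hml : m * l = H := by rw [hl]; field_simp
  set x : ℕ → ℝ := fun i => a + i * l with hx
  have hxs : ∀ i, x (i + 1) = x i + l := fun i => by simp only [hx]; push_cast; ring
  have hx0 : x 0 = a := by simp [hx]
  have hxm : x m = a + H := by simp [hx, hml]
  have hxlt : ∀ i, x i < x (i + 1) := fun i => by rw [hxs]; linarith
  have hmono : Monotone x := monotone_nat_of_le_succ fun i => (hxlt i).le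
  have hsub : ∀ i < m, Icc (x i) (x (i + 1)) ⊆ I := fun i hi =>
    Icc_subset_Icc (by rw [← hx0]; exact hmono (Nat.zero_le i)) (by rw [← hxm]; exact hmono hi)
  have hval : ∀ i ≤ m, s (x i) = 0 := fun i hi => hs.value ⟨i, Nat.lt_succ_of_le hi⟩
  have hpiece : ∀ i < m, ∃ c₀ c₁ c₂ c₃ : ℝ, ∀ t ∈ Icc (x i) (x (i + 1)),
      s t = c₀ + c₁ * t + c₂ * t ^ 2 + c₃ * t ^ 3 ∧ s₁ t = c₁ + 2 * c₂ * t + 3 * c₃ * t ^ 2 ∧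
        s₂ t = 2 * c₂ + 6 * c₃ * t := by
    intro i hi
    obtain ⟨w, ⟨c, hc⟩, hw⟩ := hs.cubic i hi
    have hxi : a + ((i : ℝ) + 1) * (H / m) = x (i + 1) := by simp only [hx]; push_cast; ring
    rw [hxi] at hw
    change EqOn s w (Icc (x i) (x (i + 1))) at hw
    have hJ : UniqueDiffOn ℝ (Icc (x i) (x (i + 1))) := uniqueDiffOn_Icc (hxlt i)
    have e0 : ∀ t ∈ Icc (x i) (x (i + 1)), s t = c 0 + c 1 * t + c 2 * t ^ 2 + c 3 * t ^ 3 := by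
      intro t ht
      rw [hw ht, hc t, Fin.sum_univ_four]
      simp only [smul_eq_mul]
      norm_num
      ring
    have e1 : ∀ t ∈ Icc (x i) (x (i + 1)), s₁ t = c 1 + 2 * c 2 * t + 3 * c 3 * t ^ 2 := by
      intro t ht
      refine (hJ t ht).eq_deriv _ ((hd1 t (hsub i hi ht)).mono (hsub i hi)) ?_
      have h : HasDerivAt (fun t => c 0 + c 1 * t + c 2 * t ^ 2 + c 3 * t ^ 3)
          (c 1 + 2 * c 2 * t + 3 * c 3 * t ^ 2) t := by
        have h1 := (hasDerivAt_id t).const_mul (c 1)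
        have h2 := ((hasDerivAt_id t).fun_pow 2).const_mul (c 2)
        have h3 := ((hasDerivAt_id t).fun_pow 3).const_mul (c 3)
        refine (((h1.const_add (c 0)).add h2).add h3).congr_deriv ?_
        simp
        ring
      exact h.hasDerivWithinAt.congr e0 (e0 t ht)
    have e2 : ∀ t ∈ Icc (x i) (x (i + 1)), s₂ t = 2 * c 2 + 6 * c 3 * t := by
      intro t ht
      refine (hJ t ht).eq_deriv _ ((hd2 t (hsub i hi ht)).mono (hsub i hi)) ?_
      have h : HasDerivAt (fun t => c 1 + 2 * c 2 * t + 3 * c 3 * t ^ 2)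
          (2 * c 2 + 6 * c 3 * t) t := by
        have h1 := (hasDerivAt_id t).const_mul (2 * c 2)
        have h2 := ((hasDerivAt_id t).fun_pow 2).const_mul (3 * c 3)
        refine ((h1.const_add (c 1)).add h2).congr_deriv ?_
        simp
        ring
      exact h.hasDerivWithinAt.congr e1 (e1 t ht)
    exact ⟨c 0, c 1, c 2, c 3, fun t ht => ⟨e0 t ht, e1 t ht, e2 t ht⟩⟩
  have hleft : ∀ i, x i ∈ Icc (x i) (x (i + 1)) := fun i => ⟨le_rfl, (hxlt i).le⟩
  have hright : ∀ i, x (i + 1) ∈ Icc (x i) (x (i + 1)) := fun i => ⟨(hxlt i).le, le_rfl⟩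
  -- The right-hand side is l times the integral of s''², expressed by the two end slopes; it is a
  -- positive definite form in them.
  have henergy : ∀ i < m, l * (s₂ (x (i + 1)) * s₁ (x (i + 1)) - s₂ (x i) * s₁ (x i))
      = 4 * (s₁ (x i) ^ 2 + s₁ (x i) * s₁ (x (i + 1)) + s₁ (x (i + 1)) ^ 2) := by
    intro i hi
    obtain ⟨c₀, c₁, c₂, c₃, hc⟩ := hpiece i hi
    have v0 := (hc _ (hleft i)).1
    have v1 := (hc _ (hright i)).1
    rw [hval i hi.le] at v0
    rw [hval (i + 1) hi] at v1
    rw [(hc _ (hleft i)).2.1, (hc _ (hright i)).2.1, (hc _ (hleft i)).2.2, (hc _ (hright i)).2.2]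
    rw [hxs] at v1 ⊢
    have e : l * (c₁ + c₂ * (2 * x i + l) + c₃ * (3 * x i ^ 2 + 3 * x i * l + l ^ 2)) = 0 := by
      linear_combination v0 - v1
    have e' : c₁ = -(c₂ * (2 * x i + l) + c₃ * (3 * x i ^ 2 + 3 * x i * l + l ^ 2)) := by
      have := (mul_eq_zero.1 e).resolve_left hl0.ne'
      linarith
    rw [e']
    ring
  have hs₁0 : s₁ (x 0) = 0 := by
    rw [hx0]
    have ha : a ∈ I := ⟨le_rfl, by linarith⟩
    exact (hU a ha).eq_deriv _ (hd1 a ha) hs.slope_left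
  have hs₁m : s₁ (x m) = 0 := by
    rw [hxm]
    have ha : a + H ∈ I := ⟨by linarith, le_rfl⟩
    exact (hU _ ha).eq_deriv _ (hd1 _ ha) hs.slope_right
  have hnonneg : ∀ i ∈ Finset.range m,
      0 ≤ s₂ (x (i + 1)) * s₁ (x (i + 1)) - s₂ (x i) * s₁ (x i) := by
    intro i hi
    have h := henergy i (Finset.mem_range.1 hi)
    by_contra hneg
    nlinarith [sq_nonneg (s₁ (x i) + s₁ (x (i + 1))), sq_nonneg (s₁ (x i)),
      sq_nonneg (s₁ (x (i + 1))), mul_pos hl0 (sub_pos.2 (not_le.1 hneg))]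
  have hsum : ∑ i ∈ Finset.range m, (s₂ (x (i + 1)) * s₁ (x (i + 1)) - s₂ (x i) * s₁ (x i)) = 0 := by
    rw [Finset.sum_range_sub (fun i => s₂ (x i) * s₁ (x i)), hs₁0, hs₁m]
    ring
  have hzero := (Finset.sum_eq_zero_iff_of_nonneg hnonneg).1 hsum
  have hslope : ∀ i < m, s₁ (x i) = 0 ∧ s₁ (x (i + 1)) = 0 := by
    intro i hi
    have h := henergy i hi
    rw [hzero i (Finset.mem_range.2 hi), mul_zero] at h
    constructor <;>
    nlinarith [sq_nonneg (s₁ (x i) + s₁ (x (i + 1))), sq_nonneg (s₁ (x i)),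
      sq_nonneg (s₁ (x (i + 1)))]
  intro t ht
  obtain ⟨i, hi, hti⟩ : ∃ i < m, t ∈ Icc (x i) (x (i + 1)) := by
    by_contra hcon
    push Not at hcon
    have hgt : ∀ i ≤ m, x i ≤ t := by
      intro i
      induction i with
      | zero => intro _; rw [hx0]; exact ht.1
      | succ i ih =>
        intro hi
        by_contra hlt
        exact hcon i hi ⟨ih (by lia), (not_le.1 hlt).le⟩
    have htm : t = x m := le_antisymm (by rw [hxm]; exact ht.2) (hgt m le_rfl)
    obtain ⟨j, rfl⟩ : ∃ j, m = j + 1 := ⟨m - 1, by lia⟩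
    exact hcon j (by lia) (htm ▸ hright j)
  obtain ⟨c₀, c₁, c₂, c₃, hc⟩ := hpiece i hi
  have v0 := (hc _ (hleft i)).1
  have v1 := (hc _ (hright i)).1
  have w0 := (hc _ (hleft i)).2.1
  have w1 := (hc _ (hright i)).2.1
  rw [hval i hi.le] at v0
  rw [hval (i + 1) hi] at v1
  rw [(hslope i hi).1] at w0
  rw [(hslope i hi).2] at w1
  rw [hxs] at v1 w1
  have hc₃ : c₃ = 0 := by
    have : l ^ 3 * c₃ = 0 := by linear_combination -l * w0 - l * w1 - 2 * v0 + 2 * v1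
    exact (mul_eq_zero.1 this).resolve_left (by positivity)
  subst hc₃
  have hc₂ : c₂ = 0 := by
    have : l * c₂ = 0 := by linear_combination (w0 - w1) / 2
    exact (mul_eq_zero.1 this).resolve_left (by positivity)
  subst hc₂
  have hc₁ : c₁ = 0 := by linarith
  subst hc₁
  rw [(hc t hti).1]
  linarith

variable {E F : Type*} [NormedAddCommGroup E] [NormedSpace ℝ E] [NormedAddCommGroup F]
  [NormedSpace ℝ F]

theorem IsCubic.clm_comp {w : ℝ → E} (hw : IsCubic w) (L : E →L[ℝ] F) :
    IsCubic fun t => L (w t) := by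
  obtain ⟨c, hc⟩ := hw
  exact ⟨fun k => L (c k), fun t => by simp [hc t]⟩

theorem IsCubic.sub {w₁ w₂ : ℝ → E} (h₁ : IsCubic w₁) (h₂ : IsCubic w₂) :
    IsCubic fun t => w₁ t - w₂ t := by
  obtain ⟨c₁, hc₁⟩ := h₁
  obtain ⟨c₂, hc₂⟩ := h₂
  exact ⟨fun k => c₁ k - c₂ k, fun t => by simp [hc₁, hc₂, smul_sub, Finset.sum_sub_distrib]⟩

theorem IsClampedCubicSpline.clm_comp {m : ℕ} {a H : ℝ} {v : Fin (m + 1) → E} {d₀ d₁ : E}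
    {s : ℝ → E} (hs : IsClampedCubicSpline a H v d₀ d₁ s) (L : E →L[ℝ] F) :
    IsClampedCubicSpline a H (fun i => L (v i)) (L d₀) (L d₁) fun t => L (s t) where
  contDiff := L.contDiff.comp_contDiffOn hs.contDiff
  cubic i hi := by
    obtain ⟨w, hw, h⟩ := hs.cubic i hi
    exact ⟨_, hw.clm_comp L, fun t ht => congrArg L (h ht)⟩
  value i := congrArg L (hs.value i)
  slope_left := L.hasFDerivAt.comp_hasDerivWithinAt _ hs.slope_left
  slope_right := L.hasFDerivAt.comp_hasDerivWithinAt _ hs.slope_right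

theorem IsClampedCubicSpline.sub {m : ℕ} {a H : ℝ} {v v' : Fin (m + 1) → E} {d₀ d₁ d₀' d₁' : E}
    {s s' : ℝ → E} (hs : IsClampedCubicSpline a H v d₀ d₁ s)
    (hs' : IsClampedCubicSpline a H v' d₀' d₁' s') :
    IsClampedCubicSpline a H (fun i => v i - v' i) (d₀ - d₀') (d₁ - d₁') fun t => s t - s' t where
  contDiff := hs.contDiff.sub hs'.contDiff
  cubic i hi := by
    obtain ⟨w, hw, h⟩ := hs.cubic i hi
    obtain ⟨w', hw', h'⟩ := hs'.cubic i hi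
    exact ⟨_, hw.sub hw', fun t ht => by simp only [h ht, h' ht]⟩
  value i := by rw [hs.value, hs'.value]
  slope_left := hs.slope_left.sub hs'.slope_left
  slope_right := hs.slope_right.sub hs'.slope_right

/-- Uniqueness of the clamped cubic spline. -/
theorem IsClampedCubicSpline.eqOn {m : ℕ} (hm : 1 ≤ m) {a H : ℝ} (hH : 0 < H)
    {v : Fin (m + 1) → E} {d₀ d₁ : E} {s s' : ℝ → E} (hs : IsClampedCubicSpline a H v d₀ d₁ s)
    (hs' : IsClampedCubicSpline a H v d₀ d₁ s') : EqOn s s' (Icc a (a + H)) := by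
  intro t ht
  rw [← sub_eq_zero]
  -- Continuous functionals preserve clamped splines and separate points, which reduces the claim to
  -- scalar data.
  refine SeparatingDual.eq_zero_of_forall_dual_eq_zero (R := ℝ) fun φ => ?_
  have h := (hs.sub hs').clm_comp φ
  simp only [sub_self, map_zero] at h
  exact IsClampedCubicSpline.eqOn_zero hm hH h t ht

/-- Two cubic curves that agree on a nondegenerate interval are equal. -/
theorem IsCubic.eq_of_eqOn_Icc {w w' : ℝ → E} (hw : IsCubic w) (hw' : IsCubic w') {a b : ℝ}
    (hab : a < b) (h : EqOn w w' (Icc a b)) : w = w' := by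
  funext t
  rw [← sub_eq_zero]
  refine SeparatingDual.eq_zero_of_forall_dual_eq_zero (R := ℝ) fun φ => ?_
  obtain ⟨c, hc⟩ := (hw.sub hw').clm_comp φ
  set Q : Polynomial ℝ := ∑ k : Fin 4, Polynomial.C (c k) * Polynomial.X ^ (k : ℕ) with hQ
  have hQe : ∀ t, Q.eval t = φ (w t - w' t) := fun t => by
    refine Eq.trans ?_ (hc t).symm
    rw [hQ, Polynomial.eval_finsetSum]
    refine Finset.sum_congr rfl fun k _ => ?_
    rw [Polynomial.eval_mul, Polynomial.eval_C, Polynomial.eval_pow, Polynomial.eval_X, smul_eq_mul,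
      mul_comm]
  have hQ0 : Q = 0 := by
    refine Polynomial.eq_of_infinite_eval_eq Q 0 ((Icc_infinite hab).mono fun t ht => ?_)
    show Q.eval t = (0 : Polynomial ℝ).eval t
    rw [hQe, h ht]
    simp
  rw [← hQe, hQ0, Polynomial.eval_zero]

end ClampedSplineUniqueness

/-! ### Existence of the clamped cubic spline via truncated powers -/

section ClampedSplineExistence

open Set Polynomial

/-- At 0 both branches have derivative zero because the exponent is at least two. Away from a closed
half-line the statement relative to it is vacuous, so the two half-lines can be glued. -/
theorem hasDerivAt_max_zero_pow (n : ℕ) (x : ℝ) :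
    HasDerivAt (fun x : ℝ => max x 0 ^ (n + 2)) ((n + 2 : ℕ) * max x 0 ^ (n + 1)) x := by
  have hpow : ∀ x : ℝ, HasDerivAt (fun x : ℝ => x ^ (n + 2)) ((n + 2 : ℕ) * x ^ (n + 1)) x :=
    fun x => by simpa using hasDerivAt_pow (n + 2) x
  rw [← hasDerivWithinAt_univ, ← Iic_union_Ici (a := (0 : ℝ))]
  refine HasDerivWithinAt.union ?_ ?_
  · rcases le_or_gt x 0 with h | h
    · have h0 : HasDerivWithinAt (fun _ : ℝ => (0 : ℝ)) 0 (Iic 0) x := hasDerivWithinAt_const _ _ _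
      have h1 : ∀ y ∈ Iic (0 : ℝ), max y 0 ^ (n + 2) = 0 := fun y hy => by
        rw [max_eq_right hy]; simp
      refine (h0.congr h1 (h1 x h)).congr_deriv ?_
      rw [max_eq_right h]; simp
    · exact hasDerivWithinAt_iff_hasFDerivWithinAt.2
        (HasFDerivWithinAt.of_notMem_closure (by simpa using h))
  · rcases le_or_gt 0 x with h | h
    · have h1 : ∀ y ∈ Ici (0 : ℝ), max y 0 ^ (n + 2) = y ^ (n + 2) := fun y hy => by
        rw [max_eq_left hy]
      refine ((hpow x).hasDerivWithinAt.congr h1 (h1 x h)).congr_deriv ?_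
      rw [max_eq_left h]
    · exact hasDerivWithinAt_iff_hasFDerivWithinAt.2
        (HasFDerivWithinAt.of_notMem_closure (by simpa using h))

theorem contDiff_two_max_zero_cube : ContDiff ℝ 2 (fun x : ℝ => max x 0 ^ 3) := by
  have h1 : deriv (fun x : ℝ => max x 0 ^ 3) = fun x => ((1 + 2 : ℕ) : ℝ) * max x 0 ^ 2 :=
    funext fun x => (hasDerivAt_max_zero_pow 1 x).deriv
  have h2 : deriv (fun x : ℝ => max x 0 ^ 2) = fun x => ((0 + 2 : ℕ) : ℝ) * max x 0 ^ 1 :=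
    funext fun x => (hasDerivAt_max_zero_pow 0 x).deriv
  rw [← one_add_one_eq_two, contDiff_succ_iff_deriv]
  refine ⟨fun x => (hasDerivAt_max_zero_pow 1 x).differentiableAt, by simp, ?_⟩
  rw [h1]
  refine contDiff_const.mul (contDiff_one_iff_deriv.2
    ⟨fun x => (hasDerivAt_max_zero_pow 0 x).differentiableAt, ?_⟩)
  rw [h2]
  fun_prop

/-- Cubic spline with the knots `j / (n + 1)` in the truncated power basis. -/
noncomputable def truncatedPowerSpline {n : ℕ} (c : Fin 4 → ℝ) (e : Fin n → ℝ) (θ : ℝ) : ℝ :=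
  ∑ k, c k * θ ^ (k : ℕ) + ∑ j : Fin n, e j * max (θ - ((j : ℝ) + 1) / (n + 1 : ℕ)) 0 ^ 3

/-- The derivative of `truncatedPowerSpline`. -/
noncomputable def truncatedPowerSplineDeriv {n : ℕ} (c : Fin 4 → ℝ) (e : Fin n → ℝ) (θ : ℝ) : ℝ :=
  ∑ k, c k * ((k : ℕ) * θ ^ ((k : ℕ) - 1)) +
    ∑ j : Fin n, e j * (3 * max (θ - ((j : ℝ) + 1) / (n + 1 : ℕ)) 0 ^ 2)

/-- The polynomial that agrees with `truncatedPowerSpline` on the `i`-th subinterval. -/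
noncomputable def truncatedPowerPiece {n : ℕ} (c : Fin 4 → ℝ) (e : Fin n → ℝ) (i : ℕ) : ℝ[X] :=
  ∑ k : Fin 4, C (c k) * X ^ (k : ℕ) +
    ∑ j : Fin n, if (j : ℕ) + 1 ≤ i then C (e j) * (X - C (((j : ℝ) + 1) / (n + 1 : ℕ))) ^ 3 else 0

variable {n : ℕ} (c : Fin 4 → ℝ) (e : Fin n → ℝ)

theorem contDiff_truncatedPowerSpline : ContDiff ℝ 2 (truncatedPowerSpline c e) := by
  unfold truncatedPowerSpline
  refine (ContDiff.sum fun k _ => by fun_prop).add (ContDiff.sum fun j _ => contDiff_const.mul ?_)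
  exact contDiff_two_max_zero_cube.comp (contDiff_id.sub contDiff_const)

theorem hasDerivAt_truncatedPowerSpline (θ : ℝ) :
    HasDerivAt (truncatedPowerSpline c e) (truncatedPowerSplineDeriv c e θ) θ := by
  unfold truncatedPowerSpline truncatedPowerSplineDeriv
  refine (HasDerivAt.fun_sum fun k _ => (hasDerivAt_pow _ θ).const_mul (c k)).add
    (HasDerivAt.fun_sum fun j _ => HasDerivAt.const_mul (e j) ?_)
  have h := (hasDerivAt_max_zero_pow 1 (θ - ((j : ℝ) + 1) / (n + 1 : ℕ))).comp θ
    ((hasDerivAt_id θ).sub_const (((j : ℝ) + 1) / (n + 1 : ℕ)))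
  refine h.congr_deriv ?_
  norm_num

theorem degree_truncatedPowerPiece_lt (i : ℕ) : (truncatedPowerPiece c e i).degree < (4 : ℕ) := by
  unfold truncatedPowerPiece
  rw [← mem_degreeLT]
  refine Submodule.add_mem _ (Submodule.sum_mem _ fun k _ => ?_) (Submodule.sum_mem _ fun j _ => ?_)
  · rw [mem_degreeLT]
    refine (degree_C_mul_X_pow_le _ _).trans_lt ?_
    exact_mod_cast k.2
  · split_ifs
    · rw [mem_degreeLT]
      rw [← smul_eq_C_mul]
      refine (degree_smul_le _ _).trans_lt ?_
      rw [degree_pow, degree_X_sub_C]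
      norm_num
    · exact Submodule.zero_mem _

/-- The j-th knot is (j + 1)/(n + 1). It is either at or left of the subinterval, where the
truncation is inactive, or at or right of it, where the truncated power vanishes. -/
theorem eqOn_truncatedPowerPiece (i : ℕ) :
    EqOn (truncatedPowerSpline c e) (fun θ => (truncatedPowerPiece c e i).eval θ)
      (Icc ((i : ℝ) / (n + 1 : ℕ)) (((i : ℝ) + 1) / (n + 1 : ℕ))) := by
  intro θ hθ
  have hn : (0 : ℝ) < (n + 1 : ℕ) := by positivity
  simp only [truncatedPowerSpline, truncatedPowerPiece, eval_add, eval_finsetSum, eval_mul, eval_C,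
    eval_pow, eval_X]
  congr 1
  refine Finset.sum_congr rfl fun j _ => ?_
  split_ifs with h
  · have h' : (j : ℝ) + 1 ≤ i := by exact_mod_cast h
    have h1 : ((j : ℝ) + 1) / (n + 1 : ℕ) ≤ i / (n + 1 : ℕ) := by gcongr
    rw [max_eq_left (by linarith [hθ.1])]
    simp
  · have h' : (i : ℝ) ≤ j := by exact_mod_cast (by lia : i ≤ (j : ℕ))
    have h1 : ((i : ℝ) + 1) / (n + 1 : ℕ) ≤ (j + 1) / (n + 1 : ℕ) := by gcongr
    rw [max_eq_right (by linarith [hθ.2])]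
    simp

theorem Polynomial.isCubic_eval_div_smul {E : Type*} [NormedAddCommGroup E] [NormedSpace ℝ E]
    {ψ : ℝ[X]} (hψ : ψ.degree < (4 : ℕ)) (a H : ℝ) (ζ : E) :
    IsCubic fun t => ψ.eval ((t - a) / H) • ζ := by
  set Q := ψ.comp (C H⁻¹ * (X - C a)) with hQ
  have hdeg : Q.natDegree < 4 := by
    refine natDegree_comp_le.trans_lt ?_
    have h1 : ψ.natDegree < 4 := by
      by_cases h0 : ψ = 0
      · simp [h0]
      · exact (natDegree_lt_iff_degree_lt h0).2 hψ
    have h2 : (C H⁻¹ * (X - C a)).natDegree ≤ 1 :=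
      (natDegree_C_mul_le _ _).trans (natDegree_X_sub_C a).le
    nlinarith
  refine ⟨fun k => Q.coeff k • ζ, fun t => ?_⟩
  have h1 : ψ.eval ((t - a) / H) = Q.eval t := by
    rw [hQ, eval_comp]; simp [div_eq_inv_mul]
  show ψ.eval ((t - a) / H) • ζ = _
  rw [h1, eval_eq_sum_range' hdeg, Finset.sum_range, Finset.sum_smul]
  exact Finset.sum_congr rfl fun k _ => by rw [smul_smul, mul_comm]

/-- The link that makes the uniqueness theorem applicable to the truncated power basis. -/
theorem isClampedCubicSpline_truncatedPowerSpline :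
    IsClampedCubicSpline (m := n + 1) 0 1
      (fun i => truncatedPowerSpline c e ((i : ℝ) / (n + 1 : ℕ))) (truncatedPowerSplineDeriv c e 0)
      (truncatedPowerSplineDeriv c e 1) (truncatedPowerSpline c e) where
  contDiff := (contDiff_truncatedPowerSpline c e).contDiffOn
  cubic i _ := by
    refine ⟨_, isCubic_eval_div_smul (degree_truncatedPowerPiece_lt c e i) 0 1 (1 : ℝ), ?_⟩
    have h := eqOn_truncatedPowerPiece c e i
    simpa [div_eq_mul_inv] using h
  value i := by simp [div_eq_mul_inv]
  slope_left := (hasDerivAt_truncatedPowerSpline c e 0).hasDerivWithinAt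
  slope_right := by
    rw [zero_add]; exact (hasDerivAt_truncatedPowerSpline c e 1).hasDerivWithinAt

/-- No truncated power is active on the first subinterval, so the polynomial part vanishes there and
hence everywhere. Then the node (i + 2)/(n + 1) sees only the knots up to the i-th, which yields the
remaining coefficients one after another. -/
theorem truncatedPowerSpline_coeff_eq_zero
    (h : ∀ θ ∈ Icc (0 : ℝ) 1, truncatedPowerSpline c e θ = 0) : c = 0 ∧ e = 0 := by
  have hn : (0 : ℝ) < (n + 1 : ℕ) := by positivity
  have hc : c = 0 := by
    have h0 : truncatedPowerPiece c e 0 = 0 := by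
      refine eq_of_infinite_eval_eq _ 0 ((Icc_infinite (a := (0 : ℝ)) (b := 1 / (n + 1 : ℕ))
        (by positivity)).mono fun θ hθ => ?_)
      have h1 := eqOn_truncatedPowerPiece c e 0 (x := θ) (by simpa using hθ)
      have h2 : (1 : ℝ) / (n + 1 : ℕ) ≤ 1 := by
        rw [div_le_one hn]; exact_mod_cast Nat.le_add_left 1 n
      rw [h θ ⟨hθ.1, hθ.2.trans h2⟩] at h1
      simpa using h1.symm
    have h1 : (∑ k : Fin 4, C (c k) * X ^ (k : ℕ) : ℝ[X]) = 0 := by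
      simpa [truncatedPowerPiece] using h0
    funext k
    have h2 := congrArg (fun q : ℝ[X] => q.coeff k) h1
    simpa [finsetSum_coeff, coeff_C_mul, coeff_X_pow, Fin.val_inj] using h2
  refine ⟨hc, ?_⟩
  subst hc
  have key : ∀ i : ℕ, ∀ hi : i < n, e ⟨i, hi⟩ = 0 := by
    intro i
    induction i using Nat.strong_induction_on with
    | _ i ih =>
      intro hi
      have hin : ((i : ℝ) + 2) ≤ (n + 1 : ℕ) := by exact_mod_cast (by lia : i + 2 ≤ n + 1)
      have h1 := h (((i : ℝ) + 2) / (n + 1 : ℕ)) ⟨by positivity, (div_le_one hn).2 hin⟩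
      simp only [truncatedPowerSpline, Pi.zero_apply, zero_mul, Finset.sum_const_zero,
        zero_add] at h1
      rw [Finset.sum_eq_single (⟨i, hi⟩ : Fin n)] at h1
      · refine (mul_eq_zero.1 h1).resolve_right (pow_ne_zero _ (ne_of_gt ?_))
        refine lt_max_of_lt_left ?_
        rw [← sub_div]
        show 0 < ((i : ℝ) + 2 - ((i : ℝ) + 1)) / ((n + 1 : ℕ) : ℝ)
        have : (i : ℝ) + 2 - ((i : ℝ) + 1) = 1 := by ring
        rw [this]; positivity
      · intro j _ hj
        have hj' : (j : ℕ) ≠ i := fun h => hj (Fin.ext h)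
        rcases Nat.lt_or_gt_of_ne hj' with hlt | hgt
        · rw [show j = ⟨(j : ℕ), j.2⟩ from rfl, ih j hlt j.2, zero_mul]
        · have h2 : (i : ℝ) + 2 ≤ (j : ℝ) + 1 := by exact_mod_cast (by lia : i + 2 ≤ (j : ℕ) + 1)
          have h3 : ((i : ℝ) + 2) / (n + 1 : ℕ) ≤ ((j : ℝ) + 1) / (n + 1 : ℕ) := by gcongr
          rw [max_eq_right (sub_nonpos.2 h3)]
          simp
      · simp
  funext j
  exact key j j.2

/-- Existence of the scalar clamped cubic spline on the unit interval. -/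
theorem exists_truncatedPowerSpline (v : Fin (n + 1 + 1) → ℝ) (d₀ d₁ : ℝ) :
    ∃ (c : Fin 4 → ℝ) (e : Fin n → ℝ),
      (∀ i : Fin (n + 1 + 1), truncatedPowerSpline c e ((i : ℝ) / (n + 1 : ℕ)) = v i) ∧
      truncatedPowerSplineDeriv c e 0 = d₀ ∧ truncatedPowerSplineDeriv c e 1 = d₁ := by
  let Ψ : ((Fin 4 → ℝ) × (Fin n → ℝ)) →ₗ[ℝ] ((Fin (n + 1 + 1) → ℝ) × ℝ × ℝ) :=
    { toFun := fun p => (fun i => truncatedPowerSpline p.1 p.2 ((i : ℝ) / (n + 1 : ℕ)),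
        truncatedPowerSplineDeriv p.1 p.2 0, truncatedPowerSplineDeriv p.1 p.2 1)
      map_add' := fun p p' => by
        simp only [truncatedPowerSpline, truncatedPowerSplineDeriv, Prod.fst_add, Prod.snd_add,
          Pi.add_apply, add_mul, Finset.sum_add_distrib, Prod.mk_add_mk]
        refine Prod.ext (funext fun i => ?_) (Prod.ext ?_ ?_)
        · simp only [Pi.add_apply]; ring
        · ring
        · ring
      map_smul' := fun r p => by
        simp only [truncatedPowerSpline, truncatedPowerSplineDeriv, Prod.smul_fst, Prod.smul_snd,
          Pi.smul_apply, smul_eq_mul, mul_assoc, ← Finset.mul_sum, ← mul_add, RingHom.id_apply]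
        rfl }
  have hinj : Function.Injective Ψ := by
    rw [injective_iff_map_eq_zero]
    rintro ⟨c, e⟩ hce
    have h1 := isClampedCubicSpline_truncatedPowerSpline c e
    have h2 : (fun i : Fin (n + 1 + 1) => truncatedPowerSpline c e ((i : ℝ) / (n + 1 : ℕ))) = 0 :=
      congrArg Prod.fst hce
    have h3 : truncatedPowerSplineDeriv c e 0 = 0 := congrArg (fun z => z.2.1) hce
    have h4 : truncatedPowerSplineDeriv c e 1 = 0 := congrArg (fun z => z.2.2) hce
    rw [h2, h3, h4] at h1
    have h5 := h1.eqOn_zero (by lia) one_pos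
    rw [zero_add] at h5
    obtain ⟨rfl, rfl⟩ := truncatedPowerSpline_coeff_eq_zero c e h5
    rfl
  have hsurj : Function.Surjective Ψ :=
    -- Dimension count: 4 + n coefficients against n + 2 node values and 2 slopes.
    (LinearMap.injective_iff_surjective_of_finrank_eq_finrank (by simp; lia)).1 hinj
  obtain ⟨⟨c, e⟩, hce⟩ := hsurj (v, d₀, d₁)
  exact ⟨c, e, fun i => congrFun (congrArg Prod.fst hce) i, congrArg (fun z => z.2.1) hce,
    congrArg (fun z => z.2.2) hce⟩

end ClampedSplineExistence

/-! ### The clamped cubic rule has order four -/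

section ClampedCubicRule

open Set Polynomial

theorem IsCubic.sum {ι E : Type*} [Fintype ι] [NormedAddCommGroup E] [NormedSpace ℝ E]
    {w : ι → ℝ → E} (hw : ∀ j, IsCubic (w j)) : IsCubic fun t => ∑ j, w j t := by
  choose c hc using hw
  refine ⟨fun k => ∑ j, c j k, fun t => ?_⟩
  simp only [hc, Finset.smul_sum]
  exact Finset.sum_comm

/-- A cardinal basis for clamped cubic splines on the unit interval: `inl i` belongs to the value at
the `i`-th node, `inr false` and `inr true` to the left and right end slopes. -/
theorem exists_cardinal_splines (n : ℕ) :
    ∃ (c : Fin (n + 1 + 1) ⊕ Bool → Fin 4 → ℝ) (e : Fin (n + 1 + 1) ⊕ Bool → Fin n → ℝ),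
      (∀ j (i : Fin (n + 1 + 1)), truncatedPowerSpline (c j) (e j) ((i : ℝ) / (n + 1 : ℕ))
        = if j = Sum.inl i then 1 else 0) ∧
      (∀ j, truncatedPowerSplineDeriv (c j) (e j) 0 = if j = Sum.inr false then 1 else 0) ∧
      ∀ j, truncatedPowerSplineDeriv (c j) (e j) 1 = if j = Sum.inr true then 1 else 0 := by
  choose c e h using fun j : Fin (n + 1 + 1) ⊕ Bool => exists_truncatedPowerSpline (n := n)
    (fun i => if j = Sum.inl i then 1 else 0) (if j = Sum.inr false then 1 else 0)
    (if j = Sum.inr true then 1 else 0)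
  exact ⟨c, e, fun j => (h j).1, fun j => (h j).2.1, fun j => (h j).2.2⟩

variable {n : ℕ} {c : Fin (n + 1 + 1) ⊕ Bool → Fin 4 → ℝ} {e : Fin (n + 1 + 1) ⊕ Bool → Fin n → ℝ}
  {E : Type*} [NormedAddCommGroup E] [NormedSpace ℝ E]

/-- Cardinal splines on the unit interval are transported to the window by scaling. The weight H on
the slopes cancels the 1/H from the chain rule. -/
theorem isClampedCubicSpline_sum_cardinal
    (hval : ∀ j (i : Fin (n + 1 + 1)), truncatedPowerSpline (c j) (e j) ((i : ℝ) / (n + 1 : ℕ))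
      = if j = Sum.inl i then 1 else 0)
    (hleft : ∀ j, truncatedPowerSplineDeriv (c j) (e j) 0 = if j = Sum.inr false then 1 else 0)
    (hright : ∀ j, truncatedPowerSplineDeriv (c j) (e j) 1 = if j = Sum.inr true then 1 else 0)
    {a H : ℝ} (hH : 0 < H) (v : Fin (n + 1 + 1) → E) (d₀ d₁ : E) :
    IsClampedCubicSpline a H v d₀ d₁ fun t => ∑ j, truncatedPowerSpline (c j) (e j) ((t - a) / H) •
      (Sum.elim v (fun b => cond b (H • d₁) (H • d₀)) j) := by
  set ζ : Fin (n + 1 + 1) ⊕ Bool → E := Sum.elim v fun b => cond b (H • d₁) (H • d₀) with hζ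
  have hderiv : ∀ t, HasDerivAt (fun t => ∑ j, truncatedPowerSpline (c j) (e j) ((t - a) / H) • ζ j)
      (∑ j, (truncatedPowerSplineDeriv (c j) (e j) ((t - a) / H) * (1 / H)) • ζ j) t := by
    intro t
    refine HasDerivAt.fun_sum fun j _ => ?_
    have h := (hasDerivAt_truncatedPowerSpline (c j) (e j) ((t - a) / H)).comp t
      (((hasDerivAt_id t).sub_const a).div_const H)
    exact h.smul_const (ζ j)
  refine ⟨?_, fun i hi => ?_, fun i => ?_, ?_, ?_⟩
  · refine (ContDiff.sum fun j _ => ContDiff.smul ?_ contDiff_const).contDiffOn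
    exact (contDiff_truncatedPowerSpline (c j) (e j)).comp
      ((contDiff_id.sub contDiff_const).div_const H)
  · refine ⟨_, IsCubic.sum fun j =>
      isCubic_eval_div_smul (degree_truncatedPowerPiece_lt (c j) (e j) i) a H (ζ j), fun t ht => ?_⟩
    refine Finset.sum_congr rfl fun j _ => ?_
    rw [eqOn_truncatedPowerPiece (c j) (e j) i]
    have h1 : ∀ r : ℝ, r * (H / (n + 1 : ℕ)) = r / (n + 1 : ℕ) * H := fun r => by ring
    rw [h1, h1] at ht
    exact ⟨by rw [le_div_iff₀ hH]; linarith [ht.1], by rw [div_le_iff₀ hH]; linarith [ht.2]⟩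
  · have h1 : (a + (i : ℝ) * (H / (n + 1 : ℕ)) - a) / H = (i : ℝ) / (n + 1 : ℕ) := by
      field_simp; ring
    simp only [h1, hval, ite_smul, one_smul, zero_smul, Finset.sum_ite_eq',
      Finset.mem_univ, if_true]
    rfl
  · refine (hderiv a).hasDerivWithinAt.congr_deriv ?_
    simp only [sub_self, zero_div, hleft, ite_mul, one_mul, zero_mul, ite_smul, zero_smul,
      Finset.sum_ite_eq', Finset.mem_univ, if_true]
    simp only [hζ, Sum.elim_inr, cond_false, smul_smul]
    rw [one_div, inv_mul_cancel₀ hH.ne', one_smul]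
  · refine (hderiv (a + H)).hasDerivWithinAt.congr_deriv ?_
    rw [add_sub_cancel_left, div_self hH.ne']
    simp only [hright, ite_mul, one_mul, zero_mul, ite_smul, zero_smul,
      Finset.sum_ite_eq', Finset.mem_univ, if_true]
    simp only [hζ, Sum.elim_inr, cond_true, smul_smul]
    rw [one_div, inv_mul_cancel₀ hH.ne', one_smul]

/-- Piece n is the last of the n + 1 subintervals. The explicit formula satisfies the rule by
construction; conversely, uniqueness of the spline fixes the waveform on that subinterval, and a
cubic is determined by its values there. -/
theorem clampedCubicRule_iff
    (hval : ∀ j (i : Fin (n + 1 + 1)), truncatedPowerSpline (c j) (e j) ((i : ℝ) / (n + 1 : ℕ))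
      = if j = Sum.inl i then 1 else 0)
    (hleft : ∀ j, truncatedPowerSplineDeriv (c j) (e j) 0 = if j = Sum.inr false then 1 else 0)
    (hright : ∀ j, truncatedPowerSplineDeriv (c j) (e j) 1 = if j = Sum.inr true then 1 else 0)
    {a H : ℝ} (hH : 0 < H) (v : Fin (n + 1 + 1) → E) (d₀ d₁ : E) (w : ℝ → E) :
    clampedCubicRule (n + 1) E a H v d₀ d₁ w ↔ ∀ t : ℝ,
      w t = ∑ i, (truncatedPowerPiece (c (Sum.inl i)) (e (Sum.inl i)) n).eval ((t - a) / H) • v i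
        + H • ((truncatedPowerPiece (c (Sum.inr false)) (e (Sum.inr false)) n).eval ((t - a) / H) • d₀
          + (truncatedPowerPiece (c (Sum.inr true)) (e (Sum.inr true)) n).eval ((t - a) / H) • d₁) := by
  set ζ : Fin (n + 1 + 1) ⊕ Bool → E := Sum.elim v fun b => cond b (H • d₁) (H • d₀) with hζ
  set W : ℝ → E := fun t =>
    ∑ j, (truncatedPowerPiece (c j) (e j) n).eval ((t - a) / H) • ζ j with hW
  have hformula : ∀ t, W t
      = ∑ i, (truncatedPowerPiece (c (Sum.inl i)) (e (Sum.inl i)) n).eval ((t - a) / H) • v i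
        + H • ((truncatedPowerPiece (c (Sum.inr false)) (e (Sum.inr false)) n).eval ((t - a) / H) • d₀
          + (truncatedPowerPiece (c (Sum.inr true)) (e (Sum.inr true)) n).eval ((t - a) / H) • d₁) := by
    intro t
    simp only [hW, hζ, Fintype.sum_sum_type, Fintype.sum_bool, Sum.elim_inl, Sum.elim_inr,
      cond_true, cond_false, smul_add, smul_comm H]
    abel
  have hspline := isClampedCubicSpline_sum_cardinal hval hleft hright (a := a) hH v d₀ d₁
  rw [← hζ] at hspline
  have hWcubic : IsCubic W := IsCubic.sum fun j =>
    isCubic_eval_div_smul (degree_truncatedPowerPiece_lt (c j) (e j) n) a H (ζ j)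
  have hn : (0 : ℝ) < (n + 1 : ℕ) := by positivity
  have hHn : 0 < H / (n + 1 : ℕ) := by positivity
  have hHn1 : H / (n + 1 : ℕ) ≤ H :=
    div_le_self hH.le (by exact_mod_cast Nat.le_add_left 1 n)
  have hWeq : EqOn W (fun t => ∑ j, truncatedPowerSpline (c j) (e j) ((t - a) / H) • ζ j)
      (Icc (a + H - H / (n + 1 : ℕ)) (a + H)) := by
    intro t ht
    refine Finset.sum_congr rfl fun j _ => ?_
    rw [eqOn_truncatedPowerPiece (c j) (e j) n]
    have h1 : (n : ℝ) / (n + 1 : ℕ) * H = H - H / (n + 1 : ℕ) := by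
      push_cast; field_simp; ring
    have h2 : ((n : ℝ) + 1) / (n + 1 : ℕ) * H = H := by push_cast; field_simp
    exact ⟨by rw [le_div_iff₀ hH, h1]; linarith [ht.1], by
      rw [div_le_iff₀ hH, h2]; linarith [ht.2]⟩
  simp only [← hformula]
  constructor
  · rintro ⟨hw, s, hs, hws⟩
    refine congrFun (hw.eq_of_eqOn_Icc hWcubic (by linarith : a + H - H / (n + 1 : ℕ) < a + H) ?_)
    intro t ht
    rw [hws ht, hWeq ht]
    exact hs.eqOn (by lia) hH hspline ⟨by linarith [ht.1], ht.2⟩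
  · intro hw
    have : w = W := funext hw
    subst this
    exact ⟨hWcubic, _, hspline, hWeq⟩

/-- The clamped cubic rule has order four. -/
theorem clampedCubicRule_hasOrder {m : ℕ} (hm : 1 ≤ m) (E : Type*) [NormedAddCommGroup E]
    [NormedSpace ℝ E] : (clampedCubicRule m E).HasOrder 4 := by
  obtain ⟨n, rfl⟩ : ∃ n, m = n + 1 := ⟨m - 1, by lia⟩
  obtain ⟨c, e, hval, hleft, hright⟩ := exists_cardinal_splines n
  refine ⟨fun i => truncatedPowerPiece (c (Sum.inl i)) (e (Sum.inl i)) n,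
    truncatedPowerPiece (c (Sum.inr false)) (e (Sum.inr false)) n,
    truncatedPowerPiece (c (Sum.inr true)) (e (Sum.inr true)) n,
    fun i => degree_truncatedPowerPiece_lt _ _ n, degree_truncatedPowerPiece_lt _ _ n,
    degree_truncatedPowerPiece_lt _ _ n, fun P hP θ => ?_, fun a H v d₀ d₁ w hH =>
      clampedCubicRule_iff hval hleft hright hH v d₀ d₁ w⟩
  have hcubic : IsCubic fun t => P.eval t := by
    simpa using isCubic_eval_div_smul hP 0 1 (1 : ℝ)
  -- A polynomial of degree below four is its own clamped spline, so the explicit formula for the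
  -- rule must return it; the cardinal splines need not be computed.
  have hspline : IsClampedCubicSpline (m := n + 1) 0 1 (fun i => P.eval ((i : ℝ) / (n + 1 : ℕ)))
      (P.derivative.eval 0) (P.derivative.eval 1) fun t => P.eval t :=
    { contDiff := by
        have h := contDiff_aeval (𝕜 := ℝ) P 2
        simp only [coe_aeval_eq_eval] at h
        exact h.contDiffOn
      cubic := fun i _ => ⟨_, hcubic, fun t _ => rfl⟩
      value := fun i => by simp [div_eq_mul_inv]
      slope_left := (P.hasDerivAt 0).hasDerivWithinAt
      slope_right := by rw [zero_add]; exact (P.hasDerivAt 1).hasDerivWithinAt }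
  have h := (clampedCubicRule_iff hval hleft hright one_pos _ _ _ _).1
    ⟨hcubic, _, hspline, fun t _ => rfl⟩ θ
  simp only [sub_zero, div_one, smul_eq_mul, one_mul] at h
  rw [h, add_assoc]

end ClampedCubicRule

/-! ### The main theorem -/

theorem mainTheorem1 (dS dF m p : ℕ) (hm : 1 ≤ m) (hp : 1 ≤ p)
    (ΦS : OneStep (EuclideanSpace ℝ (Fin dS)))
    (ΦF : OneStep (EuclideanSpace ℝ (Fin dF)))
    (Φ₀ : OneStep (EuclideanSpace ℝ (Fin dS) × EuclideanSpace ℝ (Fin dF)))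
    (hS : ΦS.HasOrder p) (hF : ΦF.HasOrder p) (h₀ : Φ₀.HasOrder p) :
    (∀ (q : ℕ) (RF : SplineRule m (EuclideanSpace ℝ (Fin dF)))
        (RS : SplineRule 1 (EuclideanSpace ℝ (Fin dS))),
      1 ≤ q → RF.HasOrder q → RS.HasOrder q →
        (MultirateScheme.mk ΦS ΦF Φ₀ RF RS).IsConvergent p ∧
        (MultirateScheme.mk ΦS ΦF Φ₀ RF RS).HasOrder p (min p q)) ∧
    (MultirateScheme.mk ΦS ΦF Φ₀ (clampedCubicRule m (EuclideanSpace ℝ (Fin dF)))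
        (clampedCubicRule 1 (EuclideanSpace ℝ (Fin dS)))).IsConvergent p ∧
    (MultirateScheme.mk ΦS ΦF Φ₀ (clampedCubicRule m (EuclideanSpace ℝ (Fin dF)))
        (clampedCubicRule 1 (EuclideanSpace ℝ (Fin dS)))).HasOrder p (min p 4) ∧
    (4 ≤ p →
      (MultirateScheme.mk ΦS ΦF Φ₀ (clampedCubicRule m (EuclideanSpace ℝ (Fin dF)))
        (clampedCubicRule 1 (EuclideanSpace ℝ (Fin dS)))).HasOrder p 4) := by
  have hF4 := clampedCubicRule_hasOrder hm (EuclideanSpace ℝ (Fin dF))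
  have hS4 := clampedCubicRule_hasOrder le_rfl (EuclideanSpace ℝ (Fin dS))
  have key : ∀ (q : ℕ) (RF : SplineRule m (EuclideanSpace ℝ (Fin dF)))
      (RS : SplineRule 1 (EuclideanSpace ℝ (Fin dS))), 1 ≤ q → RF.HasOrder q → RS.HasOrder q →
        (MultirateScheme.mk ΦS ΦF Φ₀ RF RS).IsConvergent p ∧
        (MultirateScheme.mk ΦS ΦF Φ₀ RF RS).HasOrder p (min p q) := by
    intro q RF RS hq hRF hRS
    have h : (MultirateScheme.mk ΦS ΦF Φ₀ RF RS).HasOrder p (min p q) :=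
      MultirateScheme.hasOrder_min hm hp hq hS hF h₀ hRF hRS
    exact ⟨h.isConvergent (by lia), h⟩
  have h4 := key 4 _ _ (by norm_num) hF4 hS4
  exact ⟨key, h4.1, h4.2, fun hp4 => by simpa [min_eq_right hp4] using h4.2⟩
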